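/- Let $K$ be an algebraically closed field and $R=K[x_0,x_1,x_2]$ the homogeneous coordinate ring of $\mathbb P^2=\mathbb P^2_K$. A fat point scheme $A=m_1p_1+\cdots+m_rp_r\subset\mathbb P^2$ (distinct points $p_i$, integers $m_i\ge 0$) is the subscheme defined by the ideal $I_A=\bigcap_i I_{p_i}^{m_i}$, where $I_p\subset R$ is the ideal generated by all forms vanishing at $p$. For a line $L$ with equation $F=0$, the residual scheme $A:L$ is the fat point scheme with ideal $I_{A:L}=(I_A:F)$. Write $h_{I_A}(t)=\dim_K (I_A)_t$ and $h_A(t)=\dim_K (R/I_A)_t$ (both zero for $t<0$), $\Delta h_A(t)=h_A(t)-h_A(t-1)$, let $\alpha(I_A)$ be the least $t\ge 0$ with $(I_A)_t\neq 0$, and let $\operatorname{reg}(I_A)$ be the least $t$ with $h_A(t-1)=\deg A$. In the minimal graded free resolution $$0\to\bigoplus_t R[-t]^{\sigma_t(A)}\to\bigoplus_t R[-t]^{\nu_t(A)}\to I_A\to 0,$$ the numbers $\nu_t(A)$, $\sigma_t(A)$ are the graded Betti numbers of $I_A$. Let $n\ge 0$, let $A\subset\mathbb P^2$ be a fat point scheme,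 and let $L_1,\dots,L_{n+1}$ be lines (not necessarily distinct). Put $A_0=A$, $A_i=A_{i-1}:L_i$, and $d_i=\deg(L_i\cap A_{i-1})$ for $1\le i\le n+1$. Assume that $A_{n+1}=\varnothing$, i.e. that $\mathbf d=(d_1,\dots,d_{n+1})$ is a full reduction vector for $A$, and that $\mathbf d$ is positive and strictly decreasing: $d_1>d_2>\cdots>d_{n+1}>0$. Then: 1. $\alpha(I_A)=n+1$ and $\operatorname{reg}(I_A)=d_1$. 2. $I_A$ has a minimal graded free resolution of the above form. For each integer $t$ with $\alpha(I_A)\le t<\operatorname{reg}(I_A)$, let $j$ be the greatest integer with $0\le j\le n+1$ such that $h_{I_{A_i}}(t-i)=h_{I_A}(t)$ for all $1\le i\le j$, and let $e=\Delta h_{A_j}(t-j)$. Then $$h_{I_A}(t+1)-h_{I_{A_j}}(t-j+1)+\max(2e-t+j,0)\;\le\;\nu_{t+1}(A)\;\le\; h_{I_A}(t+1)-h_{I_{A_j}}(t-j+1)+e,$$ and these lower and upper bounds are equal. 3. $\mathbf d$ determines the graded Betti numbers of $I_A$: if $A'$ is any fat point scheme in $\mathbb P^2_{K'}$, for any algebraically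 closed field $K'$, which has the same vector $\mathbf d$ as a full reduction vector (with respect to some lines $L'_1,\dots,L'_{n+1}$), then $\nu_t(A)=\nu_t(A')$ and $\sigma_t(A)=\sigma_t(A')$ for all $t$. -/

import Mathlib

open scoped LinearAlgebra.Projectivization

noncomputable section

namespace FatPoints

universe u

/-- The homogeneous coordinate ring `K[x₀, x₁, x₂]` of the projective plane. -/
abbrev CoordRing (K : Type u) [Field K] : Type u := MvPolynomial (Fin 3) K

/-- A line in the plane, given by a nonzero linear form. -/
structure Line (K : Type u) [Field K] where
  form : CoordRing K
  isHomogeneous : form.IsHomogeneous 1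
  ne_zero : form ≠ 0

/-- A fat point scheme `m₁p₁ + ⋯ + mᵣpᵣ` in the plane: finitely many points of the plane with
multiplicities; the multiplicity is `0` off the support. -/
abbrev FatPointScheme (K : Type u) [Field K] : Type u := ℙ K (Fin 3 → K) →₀ ℕ

variable {K : Type u} [Field K]

/-- The ideal of a point, generated by all forms vanishing at the point. -/
def pointIdeal (p : ℙ K (Fin 3 → K)) : Ideal (CoordRing K) :=
  Ideal.span {f | (∃ k : ℕ, f.IsHomogeneous k) ∧ MvPolynomial.eval p.rep f = 0}

/-- The ideal `I_A = ⋂ᵢ I_{pᵢ}^{mᵢ}` of a fat point scheme. -/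
def fatIdeal (A : FatPointScheme K) : Ideal (CoordRing K) :=
  ⨅ p ∈ A.support, pointIdeal p ^ A p

variable (K) in
/-- The space `R_t` of forms of degree `t`; it is zero for `t < 0`. -/
def forms (t : ℤ) : Submodule K (CoordRing K) :=
  if 0 ≤ t then MvPolynomial.homogeneousSubmodule (Fin 3) K t.toNat else ⊥

/-- The space `I_t` of forms of degree `t` in an ideal. -/
def gradedPiece (I : Ideal (CoordRing K)) (t : ℤ) : Submodule K (CoordRing K) :=
  forms K t ⊓ I.restrictScalars K

/-- The Hilbert function `h_I(t) = dim I_t` of an ideal. -/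
def hilbIdeal (I : Ideal (CoordRing K)) (t : ℤ) : ℕ :=
  Module.finrank K (gradedPiece I t)

/-- The Hilbert function `dim (R/I)_t` of the quotient by an ideal; `(R/I)_t` is the image
of `R_t` in `R/I`. -/
def hilbQuot (I : Ideal (CoordRing K)) (t : ℤ) : ℕ :=
  Module.finrank K ((forms K t).map (I.restrictScalars K).mkQ)

/-- The first difference of the Hilbert function of `R/I`. As `hilbQuot I` vanishes in negative
degrees, its value at `0` is `hilbQuot I 0`. -/
def diffHilbQuot (I : Ideal (CoordRing K)) (t : ℤ) : ℤ :=
  (hilbQuot I t : ℤ) - hilbQuot I (t - 1)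

/-- The degree of the zero-dimensional (or empty) subscheme defined by a homogeneous ideal `J`:
the constant value of `dim (R/J)_t` for all large `t`. -/
def schemeDegree (J : Ideal (CoordRing K)) : ℕ :=
  sInf {c : ℕ | ∀ᶠ t : ℤ in Filter.atTop, hilbQuot J t = c}

/-- `α(I)`: the least degree `t ≥ 0` with `I_t ≠ 0`. -/
def initialDegree (I : Ideal (CoordRing K)) : ℕ :=
  sInf {t : ℕ | gradedPiece I t ≠ ⊥}

/-- `reg(I)` for the saturated ideal `I` of a zero-dimensional scheme `A`: the least degree `t`
such that `h_A(t - 1) = deg A`. -/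
def regularity (I : Ideal (CoordRing K)) : ℕ :=
  sInf {t : ℕ | hilbQuot I ((t : ℤ) - 1) = schemeDegree I}

/-- The ideal of `A_i = A : L₁, …, L_i`, where `I` is the ideal of `A`: residuals are
taken one line at a time, with `I_{B : L} = (I_B : F)` for a linear form `F` defining `L`.
The lines are indexed from `0`, so `L ⟨i, _⟩` is the line `L_{i+1}`. -/
def residualIdeal (I : Ideal (CoordRing K)) {m : ℕ} (L : Fin m → Line K) :
    ℕ → Ideal (CoordRing K)
  | 0 => I
  | i + 1 =>
      if h : i < m then (residualIdeal I L i).colon {(L ⟨i, h⟩).form}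
      else residualIdeal I L i

/-- `d` is the reduction vector of `A` induced by the lines `L`: its entries are the degrees of
the scheme-theoretic intersections `L_{i+1} ∩ A_i`. -/
def IsReductionVector (A : FatPointScheme K) {m : ℕ} (L : Fin m → Line K) (d : Fin m → ℕ) :
    Prop :=
  ∀ i : Fin m,
    d i = schemeDegree (residualIdeal (fatIdeal A) L i ⊔ Ideal.span {(L i).form})

/-- The lines totally reduce `A`: the last residual is the empty scheme. -/
def TotallyReduces (A : FatPointScheme K) {m : ℕ} (L : Fin m → Line K) : Prop :=
  residualIdeal (fatIdeal A) L m = ⊤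

/-- `d` is a full reduction vector of `A`, induced by the lines `L`. -/
def IsFullReductionVector (A : FatPointScheme K) {m : ℕ} (L : Fin m → Line K)
    (d : Fin m → ℕ) : Prop :=
  IsReductionVector A L d ∧ TotallyReduces A L

/-- A minimal graded free resolution `0 → F₁ → F₀ → I → 0`, where
`F₀ = ⨁ᵢ R[-deg₀ i]` and `F₁ = ⨁ₖ R[-deg₁ k]`. The map `F₀ → I` sends the basis to
`gens`, and `F₁ → F₀` is given by the matrix `mat`, whose nonzero entries are forms of positive
degree. -/
structure MinimalResolution (I : Ideal (CoordRing K)) where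
  rank₀ : ℕ
  rank₁ : ℕ
  deg₀ : Fin rank₀ → ℕ
  deg₁ : Fin rank₁ → ℕ
  gens : Fin rank₀ → CoordRing K
  mat : Matrix (Fin rank₀) (Fin rank₁) (CoordRing K)
  gens_homogeneous : ∀ i, (gens i).IsHomogeneous (deg₀ i)
  mat_homogeneous : ∀ i k, mat i k ≠ 0 →
    deg₀ i < deg₁ k ∧ (mat i k).IsHomogeneous (deg₁ k - deg₀ i)
  span_gens : Ideal.span (Set.range gens) = I
  exact : ∀ v : Fin rank₀ → CoordRing K,
    ∑ i, v i * gens i = 0 ↔ ∃ w : Fin rank₁ → CoordRing K, mat.mulVec w = v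
  injective : Function.Injective mat.mulVec

/-- The Betti number `ν_t`: the number of summands `R[-t]` of `F₀`. -/
def MinimalResolution.nu {I : Ideal (CoordRing K)} (F : MinimalResolution I) (t : ℕ) : ℕ :=
  Nat.card {i : Fin F.rank₀ // F.deg₀ i = t}

/-- The Betti number `σ_t`: the number of summands `R[-t]` of `F₁`. -/
def MinimalResolution.sigma {I : Ideal (CoordRing K)} (F : MinimalResolution I) (t : ℕ) : ℕ :=
  Nat.card {k : Fin F.rank₁ // F.deg₁ k = t}

/-- The greatest `j` with `0 ≤ j ≤ m` such that `h_{I_{A_i}}(t - i) = h_{I_A}(t)` for all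
`1 ≤ i ≤ j`. -/
def splitIndex (A : FatPointScheme K) {m : ℕ} (L : Fin m → Line K) (t : ℕ) : ℕ :=
  sSup {j : ℕ | j ≤ m ∧ ∀ i : ℕ, 1 ≤ i → i ≤ j →
    hilbIdeal (residualIdeal (fatIdeal A) L i) ((t : ℤ) - i) = hilbIdeal (fatIdeal A) t}

/-- `e = Δ h_{A_j}(t - j)`, where `j = splitIndex A L t`. -/
def defect (A : FatPointScheme K) {m : ℕ} (L : Fin m → Line K) (t : ℕ) : ℤ :=
  diffHilbQuot (residualIdeal (fatIdeal A) L (splitIndex A L t))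
    ((t : ℤ) - splitIndex A L t)

/-- `h_{I_A}(t + 1) - h_{I_{A_j}}(t - j + 1)`, where `j = splitIndex A L t`. -/
def baseTerm (A : FatPointScheme K) {m : ℕ} (L : Fin m → Line K) (t : ℕ) : ℤ :=
  (hilbIdeal (fatIdeal A) ((t : ℤ) + 1) : ℤ) -
    hilbIdeal (residualIdeal (fatIdeal A) L (splitIndex A L t))
      ((t : ℤ) - splitIndex A L t + 1)

/-- The lower bound for `ν_{t+1}(A)`. -/
def bettiLower (A : FatPointScheme K) {m : ℕ} (L : Fin m → Line K) (t : ℕ) : ℤ :=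
  baseTerm A L t + max (2 * defect A L t - t + splitIndex A L t) 0

/-- The upper bound for `ν_{t+1}(A)`. -/
def bettiUpper (A : FatPointScheme K) {m : ℕ} (L : Fin m → Line K) (t : ℕ) : ℤ :=
  baseTerm A L t + defect A L t

end FatPoints

end

/-! Write m = n + 1 and index from 0: I_i is the ideal of A_i, and l_i is the linear form with
I_{i+1} = (I_i : l_i). Everything rests on the exact sequence 0 → (R/I_{i+1})(-1) → R/I_i → R/(I_i +
(l_i)) → 0 (`hilbQuot_sup_span`). Its last term is a quotient of the coordinate ring of a line with
eventual dimension d_i, so its dimension in degree t is at least min(t + 1, d_i)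
(`min_le_hilbQuot`). Strict decrease of d forces equality (`IsReductionChain.hilbQuot_sup_eq`): for
t ≥ d_i - 1 the Hilbert function of A_{i+1} is already constant in degree t - 1, and that of A_i is
nondecreasing, which leaves no room above d_i. So d determines the Hilbert function of A, and α and
reg can be read off.

The same count shows that I_i exceeds l_i I_{i+1} by one dimension in degree d_i. This yields a form
G_i in I_i of degree d_i, not divisible by l_i, with I_i = l_i I_{i+1} + (G_i)
(`IsReductionChain.exists_generator`). Starting from I_m = R, iterated mapping cones give
resolutions (`MinimalResolution.exists_cone`), which stay minimal because the generators of I_{i+1}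
have degree below d_i. Hence I_A is minimally generated by l_0 ⋯ l_{m-1}, of degree m, and by the
l_0 ⋯ l_{k-1} G_k, of degree d_k + k.

Betti numbers do not depend on the resolution: ν_t is the dimension of (I/𝔪I)_t, and σ follows from
ν and the Hilbert function. For the bounds, j is the first index with d_j + j ≤ t, or m if there is
none. There e = 0, and both bounds collapse to the number of k with d_k + k = t + 1. -/

noncomputable section

namespace FatPoints

universe u

open MvPolynomial

/-! ### Graded pieces and Hilbert functions of homogeneous ideals. -/

section Forms

variable {K : Type u} [Field K]

theorem mem_forms_natCast {n : ℕ} {f : CoordRing K} :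
    f ∈ forms K (n : ℤ) ↔ f.IsHomogeneous n := by
  simp [forms]

theorem forms_of_neg {t : ℤ} (ht : t < 0) : forms K t = ⊥ := by
  simp [forms, ht]

theorem mul_mem_forms {s t : ℤ} {f g : CoordRing K} (hf : f ∈ forms K s) (hg : g ∈ forms K t) :
    f * g ∈ forms K (s + t) := by
  rcases lt_or_ge s 0 with hs | hs
  · rw [forms_of_neg hs, Submodule.mem_bot] at hf
    simp [hf]
  rcases lt_or_ge t 0 with ht | ht
  · rw [forms_of_neg ht, Submodule.mem_bot] at hg
    simp [hg]
  lift s to ℕ using hs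
  lift t to ℕ using ht
  rw [mem_forms_natCast] at hf hg
  exact_mod_cast mem_forms_natCast.2 (hf.mul hg)

instance finiteDimensional_forms (t : ℤ) : FiniteDimensional K (forms K t) := by
  rcases lt_or_ge t 0 with ht | ht
  · rw [forms_of_neg ht]
    infer_instance
  · rw [forms, if_pos ht]
    exact Module.Finite.iff_fg.2 (homogeneousSubmodule_fg (Fin 3) K _)

/-- The projection of the coordinate ring onto its forms of degree `t`. -/
def formComponent (t : ℤ) : CoordRing K →ₗ[K] CoordRing K :=
  if 0 ≤ t then homogeneousComponent t.toNat else 0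

theorem formComponent_natCast (n : ℕ) :
    (formComponent (n : ℤ) : CoordRing K →ₗ[K] CoordRing K) = homogeneousComponent n := by
  simp [formComponent]

theorem formComponent_of_neg {t : ℤ} (ht : t < 0) (f : CoordRing K) : formComponent t f = 0 := by
  rw [formComponent, if_neg ht.not_ge, LinearMap.zero_apply]

theorem formComponent_mem_forms (t : ℤ) (f : CoordRing K) : formComponent t f ∈ forms K t := by
  rcases lt_or_ge t 0 with ht | ht
  · simp [formComponent_of_neg ht]
  · lift t to ℕ using ht
    rw [formComponent_natCast, mem_forms_natCast]
    exact homogeneousComponent_isHomogeneous t f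

theorem formComponent_of_mem {t : ℤ} {f : CoordRing K} (hf : f ∈ forms K t) :
    formComponent t f = f := by
  rcases lt_or_ge t 0 with ht | ht
  · rw [forms_of_neg ht, Submodule.mem_bot] at hf
    simp [hf]
  · lift t to ℕ using ht
    rw [formComponent_natCast]
    rw [mem_forms_natCast] at hf
    exact homogeneousComponent_eq_self hf

theorem formComponent_of_mem_ne {s t : ℤ} {f : CoordRing K} (hf : f ∈ forms K s) (hst : s ≠ t) :
    formComponent t f = 0 := by
  rcases lt_or_ge s 0 with hs | hs
  · rw [forms_of_neg hs, Submodule.mem_bot] at hf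
    simp [hf]
  rcases lt_or_ge t 0 with ht | ht
  · exact formComponent_of_neg ht f
  lift s to ℕ using hs
  lift t to ℕ using ht
  rw [formComponent_natCast]
  rw [mem_forms_natCast] at hf
  rw [homogeneousComponent_of_mem hf, if_neg]
  exact_mod_cast hst.symm

theorem sum_formComponent (f : CoordRing K) :
    ∑ i ∈ Finset.range (f.totalDegree + 1), formComponent (i : ℤ) f = f := by
  simp only [formComponent_natCast]
  exact sum_homogeneousComponent f

theorem formComponent_mul {a : ℤ} {g : CoordRing K} (hg : g ∈ forms K a) (t : ℤ)
    (f : CoordRing K) : formComponent t (g * f) = g * formComponent (t - a) f := by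
  conv_lhs => rw [← sum_formComponent f, Finset.mul_sum, map_sum]
  conv_rhs => rw [← sum_formComponent f, map_sum, Finset.mul_sum]
  refine Finset.sum_congr rfl fun i _ => ?_
  have hi := formComponent_mem_forms (i : ℤ) f
  by_cases h : (i : ℤ) = t - a
  · rw [h] at hi ⊢
    rw [formComponent_of_mem hi, formComponent_of_mem]
    simpa using mul_mem_forms hg hi
  · rw [formComponent_of_mem_ne hi h, mul_zero]
    exact formComponent_of_mem_ne (mul_mem_forms hg hi) (by omega)

/-- An ideal of the coordinate ring that is homogeneous for the grading by degree. -/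
def IsHomog (I : Ideal (CoordRing K)) : Prop :=
  ∀ f ∈ I, ∀ t : ℤ, formComponent t f ∈ I

theorem isHomog_top : IsHomog (⊤ : Ideal (CoordRing K)) := fun _ _ _ => Submodule.mem_top

theorem isHomog_iInf {ι : Sort*} {I : ι → Ideal (CoordRing K)} (hI : ∀ i, IsHomog (I i)) :
    IsHomog (⨅ i, I i) := fun f hf t =>
  (Submodule.mem_iInf _).2 fun i => hI i f ((Submodule.mem_iInf _).1 hf i) t

theorem IsHomog.span_mul {I : Ideal (CoordRing K)} (hI : IsHomog I) {g : CoordRing K} {a : ℤ}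
    (hg : g ∈ forms K a) : IsHomog (Ideal.span {g} * I) := by
  intro f hf t
  obtain ⟨r, hr, rfl⟩ := Ideal.mem_span_singleton_mul.1 hf
  rw [formComponent_mul hg]
  exact Ideal.mem_span_singleton_mul.2 ⟨_, hI _ hr _, rfl⟩

theorem isHomog_span_singleton {g : CoordRing K} {a : ℤ} (hg : g ∈ forms K a) :
    IsHomog (Ideal.span {g}) := by
  simpa using isHomog_top.span_mul hg

theorem IsHomog.colon {I : Ideal (CoordRing K)} (hI : IsHomog I) {g : CoordRing K} {a : ℤ}
    (hg : g ∈ forms K a) : IsHomog (Submodule.colon I {g}) := by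
  intro f hf t
  rw [Submodule.mem_colon_singleton, smul_eq_mul, mul_comm] at hf ⊢
  have := hI _ hf (t + a)
  rwa [formComponent_mul hg, add_sub_cancel_right] at this

theorem mem_gradedPiece {I : Ideal (CoordRing K)} {t : ℤ} {f : CoordRing K} :
    f ∈ gradedPiece I t ↔ f ∈ forms K t ∧ f ∈ I := Iff.rfl

theorem gradedPiece_le_forms (I : Ideal (CoordRing K)) (t : ℤ) : gradedPiece I t ≤ forms K t :=
  inf_le_left

instance finiteDimensional_gradedPiece (I : Ideal (CoordRing K)) (t : ℤ) :
    FiniteDimensional K (gradedPiece I t) :=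
  Submodule.finiteDimensional_of_le (gradedPiece_le_forms I t)

theorem gradedPiece_top (t : ℤ) : gradedPiece (⊤ : Ideal (CoordRing K)) t = forms K t :=
  inf_eq_left.2 fun _ _ => Submodule.mem_top

theorem gradedPiece_inf (I J : Ideal (CoordRing K)) (t : ℤ) :
    gradedPiece (I ⊓ J) t = gradedPiece I t ⊓ gradedPiece J t := by
  ext f
  simp only [mem_gradedPiece, Submodule.mem_inf]
  tauto

theorem gradedPiece_mono {I J : Ideal (CoordRing K)} (h : I ≤ J) (t : ℤ) :
    gradedPiece I t ≤ gradedPiece J t := fun _ hf => ⟨hf.1, h hf.2⟩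

theorem gradedPiece_sup {I J : Ideal (CoordRing K)} (hI : IsHomog I) (hJ : IsHomog J) (t : ℤ) :
    gradedPiece (I ⊔ J) t = gradedPiece I t ⊔ gradedPiece J t := by
  refine le_antisymm (fun f hf => ?_)
    (sup_le (gradedPiece_mono le_sup_left t) (gradedPiece_mono le_sup_right t))
  obtain ⟨hft, hf⟩ := mem_gradedPiece.1 hf
  obtain ⟨a, ha, b, hb, rfl⟩ := Submodule.mem_sup.1 hf
  refine Submodule.mem_sup.2 ⟨formComponent t a, ⟨formComponent_mem_forms t a,
    hI _ ha t⟩, formComponent t b, ⟨formComponent_mem_forms t b,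
    hJ _ hb t⟩, ?_⟩
  rw [← map_add, formComponent_of_mem hft]

theorem gradedPiece_span_mul {I : Ideal (CoordRing K)} (hI : IsHomog I) {g : CoordRing K} {a : ℤ}
    (hg : g ∈ forms K a) (t : ℤ) :
    gradedPiece (Ideal.span {g} * I) t =
      (gradedPiece I (t - a)).map (LinearMap.mulLeft K g) := by
  ext f
  rw [mem_gradedPiece, Submodule.mem_map]
  constructor
  · rintro ⟨hft, hf⟩
    obtain ⟨r, hr, rfl⟩ := Ideal.mem_span_singleton_mul.1 hf
    refine ⟨formComponent (t - a) r, ⟨formComponent_mem_forms _ _,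
      hI _ hr _⟩, ?_⟩
    rw [LinearMap.mulLeft_apply, ← formComponent_mul hg, formComponent_of_mem hft]
  · rintro ⟨r, ⟨hr, hrI⟩, rfl⟩
    rw [LinearMap.mulLeft_apply]
    exact ⟨by simpa using mul_mem_forms hg hr, Ideal.mem_span_singleton_mul.2 ⟨r, hrI, rfl⟩⟩

theorem hilbIdeal_mono {I J : Ideal (CoordRing K)} (h : I ≤ J) (t : ℤ) :
    hilbIdeal I t ≤ hilbIdeal J t :=
  Submodule.finrank_mono (gradedPiece_mono h t)

theorem hilbIdeal_of_neg (I : Ideal (CoordRing K)) {t : ℤ} (ht : t < 0) : hilbIdeal I t = 0 := by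
  have h := gradedPiece_le_forms I t
  rw [forms_of_neg ht, le_bot_iff] at h
  rw [hilbIdeal, h, finrank_bot]

theorem hilbIdeal_span_mul {I : Ideal (CoordRing K)} (hI : IsHomog I) {g : CoordRing K} {a : ℤ}
    (hg : g ∈ forms K a) (hg0 : g ≠ 0) (t : ℤ) :
    hilbIdeal (Ideal.span {g} * I) t = hilbIdeal I (t - a) := by
  rw [hilbIdeal, gradedPiece_span_mul hI hg]
  exact ((gradedPiece I (t - a)).equivMapOfInjective (LinearMap.mulLeft K g)
    (mul_right_injective₀ hg0)).finrank_eq.symm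

theorem hilbIdeal_span {g : CoordRing K} {a : ℤ} (hg : g ∈ forms K a) (hg0 : g ≠ 0) (t : ℤ) :
    hilbIdeal (Ideal.span {g}) t = hilbIdeal (⊤ : Ideal (CoordRing K)) (t - a) := by
  simpa using hilbIdeal_span_mul isHomog_top hg hg0 t

theorem hilbIdeal_sup_add_hilbIdeal_inf {I J : Ideal (CoordRing K)} (hI : IsHomog I)
    (hJ : IsHomog J) (t : ℤ) :
    hilbIdeal (I ⊔ J) t + hilbIdeal (I ⊓ J) t = hilbIdeal I t + hilbIdeal J t := by
  simp only [hilbIdeal]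
  rw [gradedPiece_sup hI hJ, gradedPiece_inf]
  exact Submodule.finrank_sup_add_finrank_inf_eq _ _

theorem hilbQuot_add_hilbIdeal (I : Ideal (CoordRing K)) (t : ℤ) :
    hilbQuot I t + hilbIdeal I t = hilbIdeal (⊤ : Ideal (CoordRing K)) t := by
  have h := LinearMap.finrank_range_add_finrank_ker
    ((I.restrictScalars K).mkQ.domRestrict (forms K t))
  rw [hilbQuot, hilbIdeal, hilbIdeal, gradedPiece_top, ← h, LinearMap.range_domRestrict]
  congr 1
  rw [LinearMap.ker_domRestrict, Submodule.ker_mkQ,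
    (Submodule.equivSubtypeMap (forms K t) _).finrank_eq, Submodule.map_comap_subtype, gradedPiece]

theorem IsHomog.le_of_gradedPiece_le {I J : Ideal (CoordRing K)} (hI : IsHomog I)
    (h : ∀ t, gradedPiece I t ≤ gradedPiece J t) : I ≤ J := by
  intro f hf
  rw [← sum_formComponent f]
  exact Ideal.sum_mem _ fun i _ =>
    (h i ⟨formComponent_mem_forms _ f, hI _ hf _⟩).2

/-- Graded pieces are finite dimensional, so an inclusion of ideals can be upgraded to an equality
by counting dimensions; this is how generators are verified later. -/
theorem IsHomog.eq_of_le_of_hilbIdeal_le {I J : Ideal (CoordRing K)} (hJ : IsHomog J) (h : I ≤ J)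
    (hd : ∀ t, hilbIdeal J t ≤ hilbIdeal I t) : I = J :=
  le_antisymm h <| hJ.le_of_gradedPiece_le fun t =>
    (Submodule.eq_of_le_of_finrank_le (gradedPiece_mono h t) (hd t)).ge

theorem inf_span_singleton (I : Ideal (CoordRing K)) (g : CoordRing K) :
    I ⊓ Ideal.span {g} = Ideal.span {g} * Submodule.colon I {g} := by
  ext f
  rw [Submodule.mem_inf, Ideal.mem_span_singleton', Ideal.mem_span_singleton_mul]
  simp only [Submodule.mem_colon_singleton, smul_eq_mul]
  constructor
  · rintro ⟨hf, r, rfl⟩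
    exact ⟨r, hf, mul_comm _ _⟩
  · rintro ⟨r, hr, rfl⟩
    exact ⟨by rwa [mul_comm], r, mul_comm _ _⟩

/-- The exact sequence `0 → (R/(I : g))(-a) → R/I → R/(I + (g)) → 0`. -/
theorem hilbQuot_sup_span {I : Ideal (CoordRing K)} (hI : IsHomog I) {g : CoordRing K} {a : ℤ}
    (hg : g ∈ forms K a) (hg0 : g ≠ 0) (t : ℤ) :
    hilbQuot (I ⊔ Ideal.span {g}) t + hilbQuot (Submodule.colon I {g}) (t - a) = hilbQuot I t := by
  have h1 := hilbIdeal_sup_add_hilbIdeal_inf hI (isHomog_span_singleton hg) t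
  rw [inf_span_singleton, hilbIdeal_span_mul (hI.colon hg) hg hg0, hilbIdeal_span hg hg0] at h1
  have h2 := hilbQuot_add_hilbIdeal I t
  have h3 := hilbQuot_add_hilbIdeal (I ⊔ Ideal.span {g}) t
  have h4 := hilbQuot_add_hilbIdeal (Submodule.colon I {g}) (t - a)
  omega

theorem hilbIdeal_top_natCast (n : ℕ) :
    hilbIdeal (⊤ : Ideal (CoordRing K)) (n : ℤ) = (n + 2).choose 2 := by
  have h : gradedPiece (⊤ : Ideal (CoordRing K)) (n : ℤ) = homogeneousSubmodule (Fin 3) K n := by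
    rw [gradedPiece_top]
    simp [forms]
  have hs : {d : Fin 3 →₀ ℕ | d.degree = n} =
      ((Finset.univ : Finset (Fin 3)).finsuppAntidiag n : Set (Fin 3 →₀ ℕ)) := by
    ext d
    simp [Finset.mem_finsuppAntidiag, Finsupp.degree_eq_sum]
  rw [hilbIdeal, h, homogeneousSubmodule_eq_finsupp_supported, hs,
    (AddMonoidAlgebra.supportedEquivFinsupp _).finrank_eq, Module.finrank_finsupp_self,
    ← Nat.card_eq_fintype_card, Nat.card_coe_set_eq, Set.ncard_coe_finset,
    Finset.card_finsuppAntidiag_nat_eq_choose, Finset.card_univ, Fintype.card_fin,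
    show 3 + n - 1 = n + 2 by omega]
  exact Nat.choose_symm_add

/-- The dimension of degree t forms on a line. The range starts at -1, where both sides vanish, so
that t + 1 may be 0 in later counts. -/
theorem hilbIdeal_top_sub (t : ℤ) (ht : -1 ≤ t) :
    (hilbIdeal (⊤ : Ideal (CoordRing K)) t : ℤ) - hilbIdeal (⊤ : Ideal (CoordRing K)) (t - 1) =
      t + 1 := by
  rcases lt_or_ge t 0 with h | h
  · obtain rfl : t = -1 := by omega
    rw [hilbIdeal_of_neg _ h, hilbIdeal_of_neg _ (by norm_num)]
    rfl
  lift t to ℕ using h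
  rcases t with _ | t
  · have h0 := hilbIdeal_top_natCast (K := K) 0
    rw [h0, hilbIdeal_of_neg _ (by norm_num)]
    norm_num
  · have : ((t + 1 : ℕ) : ℤ) - 1 = (t : ℕ) := by push_cast; ring
    rw [this, hilbIdeal_top_natCast, hilbIdeal_top_natCast,
      show t + 1 + 2 = (t + 2) + 1 from rfl, Nat.choose_succ_succ' (t + 2) 1]
    push_cast
    simp
    ring

end Forms

/-! ### Growth of Hilbert functions on a line. -/

section Growth

variable {K : Type u} [Field K]

theorem Line.form_mem_forms (L : Line K) : L.form ∈ forms K 1 := mem_forms_natCast.2 L.isHomogeneous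

theorem prime_of_mem_forms_one {l : CoordRing K} (hl : l ∈ forms K 1) (hl0 : l ≠ 0) : Prime l := by
  rw [← UniqueFactorizationMonoid.irreducible_iff_prime]
  refine irreducible_of_totalDegree_eq_one ((mem_forms_natCast.1 hl).totalDegree hl0) fun x hx => ?_
  rw [isUnit_iff_ne_zero]
  rintro rfl
  exact hl0 (MvPolynomial.ext _ _ fun i => by simpa using zero_dvd_iff.1 (hx i))

theorem exists_eq_sum_of_mem_forms_one {l : CoordRing K} (hl : l ∈ forms K 1) :
    ∃ c : Fin 3 → K, l = ∑ i, C (c i) * X i := by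
  have h : l ∈ homogeneousSubmodule (Fin 3) K 1 := mem_forms_natCast.1 hl
  rw [homogeneousSubmodule_one_eq_span_X] at h
  obtain ⟨c, hc⟩ := (Submodule.mem_span_range_iff_exists_fun K).1 h
  exact ⟨c, by simp [← hc, smul_eq_C_mul]⟩

theorem exists_two_forms_independent_mod {l : CoordRing K} (hl : l ∈ forms K 1) (hl0 : l ≠ 0) :
    ∃ a ∈ forms K 1, ∃ b ∈ forms K 1, ¬ l ∣ a ∧ ∀ c : K, ¬ l ∣ b - C c * a := by
  obtain ⟨c, rfl⟩ := exists_eq_sum_of_mem_forms_one hl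
  obtain ⟨k, hk⟩ : ∃ k, c k ≠ 0 := by
    by_contra! h
    exact hl0 (by simp [h])
  obtain ⟨i, j, hik, hjk, hij⟩ : ∃ i j : Fin 3, i ≠ k ∧ j ≠ k ∧ i ≠ j := by
    clear hk
    revert k
    decide
  have hX : ∀ i : Fin 3, (X i : CoordRing K) ∈ forms K 1 := fun i =>
    mem_forms_natCast.2 (isHomogeneous_X K i)
  -- For i ≠ k, the point with i-th coordinate 1, k-th coordinate -c_i/c_k and remaining coordinate
  -- 0 lies on the line. Two such points detect independence modulo l.
  have key : ∀ i : Fin 3, i ≠ k →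
      eval (Pi.single i 1 + Pi.single k (-(c i / c k))) (∑ i, C (c i) * X i) = 0 := by
    intro i hi
    simp [mul_add, Finset.sum_add_distrib, Pi.single_apply]
    field_simp
    ring
  refine ⟨X i, hX i, X j, hX j, fun h => ?_, fun r h => ?_⟩
  · have h1 := map_dvd (eval (Pi.single i 1 + Pi.single k (-(c i / c k)))) h
    rw [key i hik, zero_dvd_iff] at h1
    simp [hik] at h1
  · have h1 := map_dvd (eval (Pi.single j 1 + Pi.single k (-(c j / c k)))) h
    rw [key j hjk, zero_dvd_iff] at h1
    simp [hik, hjk, hij] at h1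

/-- In a domain over an algebraically closed field, if no nontrivial combination `b - c a` vanishes,
then multiplication by `a` and `b` increases the dimension of a nonzero subspace. -/
theorem finrank_lt_finrank_of_mul_mem [IsAlgClosed K] {S : Type*} [CommRing S] [IsDomain S]
    [Algebra K S] {V W : Submodule K S} [FiniteDimensional K V] [FiniteDimensional K W]
    (hV : V ≠ ⊥) {a b : S} (ha : a ≠ 0) (hb : ∀ c : K, b - algebraMap K S c * a ≠ 0)
    (haV : ∀ v ∈ V, a * v ∈ W) (hbV : ∀ v ∈ V, b * v ∈ W) :
    Module.finrank K V < Module.finrank K W := by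
  by_contra! hle
  have : Nontrivial V := (Submodule.nontrivial_iff_ne_bot).2 hV
  let f : V →ₗ[K] W := (LinearMap.mulLeft K a).restrict haV
  let g : V →ₗ[K] W := (LinearMap.mulLeft K b).restrict hbV
  have hf : Function.Injective f := fun v w h =>
    Subtype.ext (mul_left_cancel₀ ha (congrArg Subtype.val h))
  -- Without growth, multiplication by a is an isomorphism V → W. An eigenvector v of a⁻¹b with
  -- eigenvalue c satisfies (b - c a) v = 0, impossible in a domain.
  let e : V ≃ₗ[K] W := LinearEquiv.ofBijective f ⟨hf,
    (LinearMap.injective_iff_surjective_of_finrank_eq_finrank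
    (le_antisymm (LinearMap.finrank_le_finrank_of_injective hf) hle)).1 hf⟩
  obtain ⟨c, hc⟩ := Module.End.exists_eigenvalue (e.symm.toLinearMap ∘ₗ g)
  obtain ⟨v, hv⟩ := hc.exists_hasEigenvector
  have h1 : g v = e (c • v) := by
    have := hv.apply_eq_smul
    rw [LinearMap.comp_apply, LinearEquiv.coe_coe, LinearEquiv.symm_apply_eq] at this
    exact this
  have h2 : b * (v : S) = a * (c • (v : S)) := congrArg Subtype.val h1
  refine mul_ne_zero (hb c) (fun h => hv.2 (Subtype.ext h)) (?_ : _ * (v : S) = 0)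
  rw [sub_mul, h2, Algebra.smul_def]
  ring

theorem finrank_map_mkQ_gradedPiece {l : CoordRing K} {J : Ideal (CoordRing K)}
    (hJ : Ideal.span {l} ≤ J) (t : ℤ) :
    Module.finrank K ((gradedPiece J t).map (Ideal.Quotient.mkₐ K (Ideal.span {l})).toLinearMap) +
      hilbIdeal (Ideal.span {l}) t = hilbIdeal J t := by
  have h := LinearMap.finrank_range_add_finrank_ker
    ((Ideal.Quotient.mkₐ K (Ideal.span {l})).toLinearMap.domRestrict (gradedPiece J t))
  rw [hilbIdeal, hilbIdeal, ← h, LinearMap.range_domRestrict]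
  congr 1
  rw [LinearMap.ker_domRestrict, (Submodule.equivSubtypeMap (gradedPiece J t) _).finrank_eq,
    Submodule.map_comap_subtype]
  suffices h : gradedPiece (Ideal.span {l}) t =
      gradedPiece J t ⊓ (Ideal.Quotient.mkₐ K (Ideal.span {l})).toLinearMap.ker by rw [h]
  ext f
  simp only [Submodule.mem_inf, mem_gradedPiece, LinearMap.mem_ker, AlgHom.toLinearMap_apply,
    Ideal.Quotient.mkₐ_eq_mk, Ideal.Quotient.eq_zero_iff_mem]
  exact ⟨fun ⟨h1, h2⟩ => ⟨⟨h1, hJ h2⟩, h2⟩, fun ⟨h1, h2⟩ => ⟨h1.1, h2⟩⟩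

/-- In terms of the domain R/(l), a nonzero piece (J/(l))_t has strictly smaller dimension than the
next piece, since two independent linear forms of the line act on it. -/
theorem hilbIdeal_growth [IsAlgClosed K] {l : CoordRing K} (hl : l ∈ forms K 1) (hl0 : l ≠ 0)
    {J : Ideal (CoordRing K)} (hJ : Ideal.span {l} ≤ J) {t : ℤ}
    (ht : hilbIdeal (Ideal.span {l}) t < hilbIdeal J t) :
    hilbIdeal J t + hilbIdeal (Ideal.span {l}) (t + 1) <
      hilbIdeal J (t + 1) + hilbIdeal (Ideal.span {l}) t := by
  have hprime : (Ideal.span {l}).IsPrime :=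
    (Ideal.span_singleton_prime hl0).2 (prime_of_mem_forms_one hl hl0)
  obtain ⟨a, ha, b, hb, hla, hlb⟩ := exists_two_forms_independent_mod hl hl0
  have h0 := finrank_map_mkQ_gradedPiece hJ t
  have h1 := finrank_map_mkQ_gradedPiece hJ (t + 1)
  have hmul : ∀ {c : CoordRing K}, c ∈ forms K 1 →
      ∀ v ∈ (gradedPiece J t).map (Ideal.Quotient.mkₐ K (Ideal.span {l})).toLinearMap,
        Ideal.Quotient.mkₐ K (Ideal.span {l}) c * v ∈
          (gradedPiece J (t + 1)).map (Ideal.Quotient.mkₐ K (Ideal.span {l})).toLinearMap := by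
    rintro c hc _ ⟨v, hv, rfl⟩
    refine ⟨c * v, ⟨?_, J.mul_mem_left c hv.2⟩, map_mul (Ideal.Quotient.mkₐ K (Ideal.span {l})) c v⟩
    rw [add_comm]
    exact mul_mem_forms hc hv.1
  have h2 := finrank_lt_finrank_of_mul_mem (K := K) (S := CoordRing K ⧸ Ideal.span {l})
    (V := (gradedPiece J t).map (Ideal.Quotient.mkₐ K (Ideal.span {l})).toLinearMap)
    (W := (gradedPiece J (t + 1)).map (Ideal.Quotient.mkₐ K (Ideal.span {l})).toLinearMap)
    (by
      intro h
      rw [h, finrank_bot] at h0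
      omega)
    (a := Ideal.Quotient.mkₐ K (Ideal.span {l}) a) (b := Ideal.Quotient.mkₐ K (Ideal.span {l}) b)
    (by
      rw [Ideal.Quotient.mkₐ_eq_mk, Ne, Ideal.Quotient.eq_zero_iff_mem, Ideal.mem_span_singleton]
      exact hla)
    (by
      intro c h
      rw [← AlgHom.commutes (Ideal.Quotient.mkₐ K (Ideal.span {l})), ← map_mul, ← map_sub,
        Ideal.Quotient.mkₐ_eq_mk, Ideal.Quotient.eq_zero_iff_mem, Ideal.mem_span_singleton] at h
      exact hlb c h)
    (hmul ha) (hmul hb)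
  omega

/-- The Hilbert function of a homogeneous quotient of the coordinate ring of a line is bounded
below by the minimum of `t + 1` and its eventual value. -/
theorem min_le_hilbQuot [IsAlgClosed K] {l : CoordRing K} (hl : l ∈ forms K 1) (hl0 : l ≠ 0)
    {J : Ideal (CoordRing K)} (hJ : Ideal.span {l} ≤ J) {d : ℕ}
    (hd : ∀ᶠ t : ℤ in Filter.atTop, hilbQuot J t = d) {t : ℤ} (ht : -1 ≤ t) :
    min (t + 1) d ≤ hilbQuot J t := by
  have hline : ∀ {s : ℤ}, -1 ≤ s → (hilbIdeal (⊤ : Ideal (CoordRing K)) s : ℤ) -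
      hilbIdeal (Ideal.span {l}) s = s + 1 := by
    intro s hs
    rw [hilbIdeal_span hl hl0]
    exact hilbIdeal_top_sub s hs
  by_contra! hlt
  rw [lt_min_iff] at hlt
  -- Below t + 1 the ideal of the line is nonzero; it then grows by at least 1 at each step while
  -- R/(l) grows by exactly 1. The quotient never recovers, so it cannot reach d.
  have key : ∀ n : ℕ, hilbQuot J (t + n) ≤ hilbQuot J t := by
    intro n
    induction n with
    | zero => simp
    | succ n ih =>
      have e0 := hilbQuot_add_hilbIdeal J (t + n)
      have e1 := hilbQuot_add_hilbIdeal J (t + n + 1)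
      have l0 := hline (s := t + n) (by omega)
      have l1 := hline (s := t + n + 1) (by omega)
      have := hilbIdeal_growth hl hl0 hJ (t := t + n) (by omega)
      push_cast
      rw [← add_assoc]
      omega
  obtain ⟨N, hN⟩ := Filter.eventually_atTop.1 hd
  have h1 := hN (t + (N - t).toNat) (by omega)
  have h2 := key (N - t).toNat
  omega

end Growth

/-! ### Powers of point ideals and a linear nonzerodivisor. -/

section Points

variable {K : Type u} [Field K]

theorem formComponent_mul_eq_sum (t : ℤ) (f g : CoordRing K) :
    formComponent t (f * g) = ∑ i ∈ Finset.range (f.totalDegree + 1),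
      formComponent (i : ℤ) f * formComponent (t - i) g := by
  conv_lhs => rw [← sum_formComponent f, Finset.sum_mul, map_sum]
  exact Finset.sum_congr rfl fun i _ => formComponent_mul (formComponent_mem_forms _ f) t g

theorem isHomog_span {S : Set (CoordRing K)} (hS : ∀ f ∈ S, ∃ a : ℤ, f ∈ forms K a) :
    IsHomog (Ideal.span S) := by
  intro f hf
  induction hf using Submodule.span_induction with
  | mem f hf =>
    intro t
    obtain ⟨a, ha⟩ := hS f hf
    rcases eq_or_ne a t with rfl | h
    · rw [formComponent_of_mem ha]
      exact Ideal.subset_span hf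
    · rw [formComponent_of_mem_ne ha h]
      exact Submodule.zero_mem _
  | zero => simp
  | add f g _ _ hf hg =>
    intro t
    rw [map_add]
    exact Submodule.add_mem _ (hf t) (hg t)
  | smul r f _ hf =>
    intro t
    rw [smul_eq_mul, formComponent_mul_eq_sum]
    exact Ideal.sum_mem _ fun i _ => Ideal.mul_mem_left _ _ (hf _)

theorem IsHomog.mul {I J : Ideal (CoordRing K)} (hI : IsHomog I) (hJ : IsHomog J) :
    IsHomog (I * J) := by
  intro f hf
  induction hf using Submodule.mul_induction_on' with
  | mem_mul_mem f hf g hg =>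
    intro t
    rw [formComponent_mul_eq_sum]
    exact Ideal.sum_mem _ fun i _ => Ideal.mul_mem_mul (hI f hf _) (hJ g hg _)
  | add f _ g _ hf hg =>
    intro t
    rw [map_add]
    exact Submodule.add_mem _ (hf t) (hg t)

theorem IsHomog.pow {I : Ideal (CoordRing K)} (hI : IsHomog I) (m : ℕ) : IsHomog (I ^ m) := by
  induction m with
  | zero =>
    rw [pow_zero, Ideal.one_eq_top]
    exact isHomog_top
  | succ m ih =>
    rw [pow_succ]
    exact ih.mul hI

theorem isHomog_fatIdeal (A : FatPointScheme K) : IsHomog (fatIdeal A) := by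
  refine isHomog_iInf fun p => isHomog_iInf fun _ => IsHomog.pow (isHomog_span ?_) _
  rintro f ⟨⟨k, hk⟩, -⟩
  exact ⟨k, mem_forms_natCast.2 hk⟩

theorem aeval_C_mul_of_isHomogeneous {f : CoordRing K} {k : ℕ} (hf : f.IsHomogeneous k)
    (v : Fin 3 → K) (l : CoordRing K) :
    aeval (fun i => C (v i) * l) f = C (eval v f) * l ^ k := by
  conv_lhs => rw [f.as_sum, map_sum]
  conv_rhs => rw [f.as_sum, map_sum, map_sum, Finset.sum_mul]
  refine Finset.sum_congr rfl fun d hd => ?_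
  have hk : k = ∑ i, d i := by
    have := hf (mem_support_iff.1 hd)
    rw [← this, Finsupp.weight_apply, Finsupp.sum_fintype] <;> simp
  rw [aeval_monomial, eval_monomial, Finsupp.prod_fintype _ _ (by simp),
    Finsupp.prod_fintype _ _ (by simp), hk, ← Finset.prod_pow_eq_pow_sum]
  simp only [mul_pow, Finset.prod_mul_distrib, map_mul, map_prod, map_pow, algebraMap_eq]
  ring

/-- The substitution `xᵢ ↦ vᵢ l + T (xᵢ - vᵢ l)`, which grades by the order of vanishing at `v`
when `l` takes the value `1` at `v`. -/
def orderHom (v : Fin 3 → K) (l : CoordRing K) : CoordRing K →ₐ[K] Polynomial (CoordRing K) :=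
  aeval fun i => Polynomial.C (C (v i) * l) + Polynomial.X * Polynomial.C (X i - C (v i) * l)

theorem eval_one_orderHom (v : Fin 3 → K) (l f : CoordRing K) :
    Polynomial.eval 1 (orderHom v l f) = f := by
  induction f using MvPolynomial.induction_on with
  | C a =>
    rw [orderHom, aeval_C]
    exact Polynomial.eval_C
  | add f g hf hg => rw [map_add, Polynomial.eval_add, hf, hg]
  | mul_X f i hf =>
    rw [map_mul, Polynomial.eval_mul, hf]
    simp [orderHom]

theorem eval_zero_orderHom (v : Fin 3 → K) (l f : CoordRing K) :
    Polynomial.eval 0 (orderHom v l f) = aeval (fun i => C (v i) * l) f := by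
  induction f using MvPolynomial.induction_on with
  | C a =>
    rw [orderHom, aeval_C, aeval_C]
    exact Polynomial.eval_C
  | add f g hf hg => rw [map_add, map_add, Polynomial.eval_add, hf, hg]
  | mul_X f i hf =>
    rw [map_mul, map_mul, Polynomial.eval_mul, hf]
    simp [orderHom]

/-- Setting T = 0 turns a form f of degree k into f(v) l^k. -/
theorem X_dvd_orderHom_iff {f : CoordRing K} {k : ℕ} (hf : f.IsHomogeneous k) {v : Fin 3 → K}
    {l : CoordRing K} (hl : l ≠ 0) : Polynomial.X ∣ orderHom v l f ↔ eval v f = 0 := by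
  rw [Polynomial.X_dvd_iff, Polynomial.coeff_zero_eq_eval_zero, eval_zero_orderHom,
    aeval_C_mul_of_isHomogeneous hf]
  simp [hl]

theorem exists_form_eval_eq_one {v : Fin 3 → K} (hv : v ≠ 0) :
    ∃ l : CoordRing K, l.IsHomogeneous 1 ∧ eval v l = 1 := by
  obtain ⟨i, hi⟩ := Function.ne_iff.1 hv
  exact ⟨C (v i)⁻¹ * X i, isHomogeneous_C_mul_X _ _, by simpa using inv_mul_cancel₀ hi⟩

theorem orderHom_mem_reesAlgebra (p : ℙ K (Fin 3 → K)) {l : CoordRing K} (hl : l.IsHomogeneous 1)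
    (hlp : eval p.rep l = 1) (f : CoordRing K) :
    orderHom p.rep l f ∈ reesAlgebra (pointIdeal p) := by
  induction f using MvPolynomial.induction_on with
  | C a =>
    rw [orderHom, aeval_C]
    exact (reesAlgebra (pointIdeal p)).algebraMap_mem (C a)
  | add f g hf hg =>
    rw [map_add]
    exact Subalgebra.add_mem _ hf hg
  | mul_X f i hf =>
    rw [map_mul]
    refine Subalgebra.mul_mem _ hf ?_
    rw [orderHom, aeval_X]
    refine Subalgebra.add_mem _ ((reesAlgebra (pointIdeal p)).algebraMap_mem _) ?_
    rw [Polynomial.X_mul_C, ← pow_one Polynomial.X, Polynomial.C_mul_X_pow_eq_monomial,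
      reesAlgebra.monomial_mem, pow_one]
    refine Ideal.subset_span ⟨⟨1, (isHomogeneous_X K i).sub ?_⟩, by simp [hlp]⟩
    simpa using (isHomogeneous_C (Fin 3) (p.rep i)).mul hl

/-- Generators of the point ideal become divisible by T, so its m-th power lands in (T^m).
Conversely, the coefficient of T^i lies in the i-th power, and T = 1 recovers f. -/
theorem mem_pointIdeal_pow_iff (p : ℙ K (Fin 3 → K)) {l : CoordRing K} (hl : l.IsHomogeneous 1)
    (hlp : eval p.rep l = 1) (m : ℕ) (f : CoordRing K) :
    f ∈ pointIdeal p ^ m ↔ Polynomial.X ^ m ∣ orderHom p.rep l f := by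
  have hl0 : l ≠ 0 := by
    rintro rfl
    simp at hlp
  constructor
  · intro hf
    have h1 : pointIdeal p ≤ (Ideal.span {(Polynomial.X : Polynomial (CoordRing K))}).comap
        (orderHom p.rep l) := by
      refine Ideal.span_le.2 ?_
      rintro g ⟨⟨k, hk⟩, hg⟩
      exact Ideal.mem_span_singleton.2 ((X_dvd_orderHom_iff hk hl0).2 hg)
    have h2 := Ideal.le_comap_pow _ m (Ideal.pow_right_mono h1 m hf)
    rwa [Ideal.mem_comap, Ideal.span_singleton_pow, Ideal.mem_span_singleton] at h2
  · intro hf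
    rw [← eval_one_orderHom p.rep l f, Polynomial.eval_eq_sum_range]
    refine Ideal.sum_mem _ fun i _ => ?_
    rw [one_pow, mul_one]
    rcases lt_or_ge i m with h | h
    · rw [Polynomial.X_pow_dvd_iff.1 hf i h]
      exact Submodule.zero_mem _
    · exact Ideal.pow_le_pow_right h
        ((mem_reesAlgebra_iff _ _).1 (orderHom_mem_reesAlgebra p hl hlp f) i)

/-- T is prime and does not divide the image of a form that is nonzero at p, so that form cancels
from divisibility by T^m. -/
theorem mem_pointIdeal_pow_of_mul_mem {p : ℙ K (Fin 3 → K)} {g : CoordRing K} {k : ℕ}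
    (hg : g.IsHomogeneous k) (hgp : eval p.rep g ≠ 0) {m : ℕ} {f : CoordRing K}
    (h : g * f ∈ pointIdeal p ^ m) : f ∈ pointIdeal p ^ m := by
  obtain ⟨l, hl, hlp⟩ := exists_form_eval_eq_one p.rep_nonzero
  have hl0 : l ≠ 0 := by
    rintro rfl
    simp at hlp
  rw [mem_pointIdeal_pow_iff p hl hlp] at h ⊢
  rw [map_mul] at h
  exact Polynomial.prime_X.pow_dvd_of_dvd_mul_left m
    (fun hX => hgp ((X_dvd_orderHom_iff hg hl0).1 hX)) h

/-- Some linear form is a nonzerodivisor modulo the ideal of a fat point scheme. -/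
theorem exists_regular_form [Infinite K] (A : FatPointScheme K) :
    ∃ l ∈ forms K 1, l ≠ 0 ∧ ∀ f, l * f ∈ fatIdeal A → f ∈ fatIdeal A := by
  -- The extra vector (1, 0, 0) keeps the linear form nonzero even when the support is empty.
  obtain ⟨φ, hφ⟩ := Module.exists_dual_forall_apply_ne_zero (K := K)
    (fun p : Option A.support => p.elim (Pi.single 0 1) fun p => p.1.rep) (by
      rintro (_ | p)
      · simp
      · exact p.1.rep_nonzero)
  have heval : ∀ v, eval v (∑ i, C (φ (Pi.single i 1)) * X i : CoordRing K) = φ v := by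
    intro v
    conv_rhs => rw [← Finset.univ_sum_single v, map_sum]
    rw [map_sum]
    refine Finset.sum_congr rfl fun i _ => ?_
    have : (Pi.single i (v i) : Fin 3 → K) = v i • Pi.single i 1 := by simp [← Pi.single_smul]
    rw [this, map_smul]
    simp [mul_comm]
  have hhom : (∑ i, C (φ (Pi.single i 1)) * X i : CoordRing K).IsHomogeneous 1 :=
    IsHomogeneous.sum _ _ _ fun i _ => isHomogeneous_C_mul_X _ _
  refine ⟨_, mem_forms_natCast.2 hhom, fun h => ?_, fun f hf => ?_⟩
  · have := heval (Pi.single 0 1)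
    rw [h, map_zero] at this
    exact hφ none this.symm
  · simp only [fatIdeal, Submodule.mem_iInf] at hf ⊢
    intro p hp
    refine mem_pointIdeal_pow_of_mul_mem hhom ?_ (hf p hp)
    rw [heval]
    exact hφ (some ⟨p, hp⟩)

theorem monotone_hilbQuot_of_regular {I : Ideal (CoordRing K)} (hI : IsHomog I) {l : CoordRing K}
    (hl : l ∈ forms K 1) (hl0 : l ≠ 0) (hreg : ∀ f, l * f ∈ I → f ∈ I) :
    Monotone (hilbQuot I) := by
  refine monotone_int_of_le_succ fun t => ?_
  have hcolon : Submodule.colon I {l} = I := by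
    ext f
    rw [Submodule.mem_colon_singleton, smul_eq_mul, mul_comm]
    exact ⟨hreg f, I.mul_mem_left l⟩
  have := hilbQuot_sup_span hI hl hl0 (t + 1)
  rw [hcolon, add_sub_cancel_right] at this
  omega

end Points

/-! ### Hilbert functions along a reduction chain. -/

section Chain

variable {K : Type u} [Field K]

/-- A sequence of homogeneous ideals, each the residual of the preceding one with respect to a
line, ending with the unit ideal after `m` steps, such that the degrees `d` of the successive
intersections with the lines are positive and strictly decreasing. -/
structure IsReductionChain (m : ℕ) (I : ℕ → Ideal (CoordRing K)) (l : ℕ → CoordRing K)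
    (d : ℕ → ℕ) : Prop where
  isHomog_zero : IsHomog (I 0)
  regular_zero : ∃ g ∈ forms K 1, g ≠ 0 ∧ ∀ f, g * f ∈ I 0 → f ∈ I 0
  form_mem : ∀ i < m, l i ∈ forms K 1
  form_ne_zero : ∀ i < m, l i ≠ 0
  succ_eq : ∀ i < m, I (i + 1) = Submodule.colon (I i) {l i}
  last_eq : I m = ⊤
  degree : ∀ i < m, ∀ᶠ t : ℤ in Filter.atTop, hilbQuot (I i ⊔ Ideal.span {l i}) t = d i
  pos : ∀ i < m, 0 < d i
  anti : ∀ i, i + 1 < m → d (i + 1) < d i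

namespace IsReductionChain

variable {m : ℕ} {I : ℕ → Ideal (CoordRing K)} {l : ℕ → CoordRing K} {d : ℕ → ℕ}

theorem isHomog (c : IsReductionChain m I l d) : ∀ i ≤ m, IsHomog (I i) := by
  intro i
  induction i with
  | zero => exact fun _ => c.isHomog_zero
  | succ i ih =>
    intro hi
    rw [c.succ_eq i hi]
    exact (ih (by omega)).colon (c.form_mem i hi)

theorem monotone_hilbQuot (c : IsReductionChain m I l d) :
    ∀ i ≤ m, Monotone (hilbQuot (I i)) := by
  obtain ⟨g, hg, hg0, hreg⟩ := c.regular_zero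
  intro i hi
  refine monotone_hilbQuot_of_regular (c.isHomog i hi) hg hg0 ?_
  -- A nonzerodivisor modulo I remains one modulo I : l.
  induction i with
  | zero => exact hreg
  | succ i ih =>
    intro f hf
    rw [c.succ_eq i hi, Submodule.mem_colon_singleton, smul_eq_mul] at hf ⊢
    rw [mul_assoc] at hf
    exact ih (by omega) _ hf

theorem hilbQuot_step (c : IsReductionChain m I l d) {i : ℕ} (hi : i < m) (t : ℤ) :
    hilbQuot (I i ⊔ Ideal.span {l i}) t + hilbQuot (I (i + 1)) (t - 1) = hilbQuot (I i) t := by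
  rw [c.succ_eq i hi]
  exact hilbQuot_sup_span (c.isHomog i hi.le) (c.form_mem i hi) (c.form_ne_zero i hi) t

theorem min_le [IsAlgClosed K] (c : IsReductionChain m I l d) {i : ℕ} (hi : i < m) {t : ℤ}
    (ht : -1 ≤ t) : min (t + 1) (d i) ≤ hilbQuot (I i ⊔ Ideal.span {l i}) t :=
  min_le_hilbQuot (c.form_mem i hi) (c.form_ne_zero i hi) le_sup_right (c.degree i hi) ht

/-- Descending induction from the unit ideal, where the condition on t is void. Since d drops
strictly, t ≥ d_i - 1 gives t - 1 ≥ d_{i+1} - 1, so the residual has already stabilized. -/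
theorem hilbQuot_eq [IsAlgClosed K] (c : IsReductionChain m I l d) {i : ℕ} (hi : i ≤ m) :
    ∀ t : ℤ, (i < m → (d i : ℤ) - 1 ≤ t) → hilbQuot (I i) t = ∑ k ∈ Finset.Ico i m, d k := by
  induction hi using Nat.decreasingInduction with
  | self =>
    intro t _
    have := hilbQuot_add_hilbIdeal (I m) t
    rw [c.last_eq] at this ⊢
    simpa using this
  | of_succ i hi ih =>
    intro t ht
    rw [Finset.sum_eq_sum_Ico_succ_bot hi]
    have h1 := c.pos i hi
    have key : ∀ s : ℤ, (d i : ℤ) - 1 ≤ s → hilbQuot (I i) s =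
        hilbQuot (I i ⊔ Ideal.span {l i}) s + ∑ k ∈ Finset.Ico (i + 1) m, d k := by
      intro s hs
      rw [← c.hilbQuot_step hi, ih]
      intro hi'
      have := c.anti i hi'
      omega
    obtain ⟨N, hN⟩ := Filter.eventually_atTop.1 (c.degree i hi)
    have h2 := key t (ht hi)
    -- Monotonicity bounds the value at t by a value far out, where the line term is d_i; the growth
    -- bound gives the reverse inequality.
    have h3 := key (max N t) ((ht hi).trans (le_max_right _ _))
    rw [hN _ (le_max_left _ _)] at h3
    have h4 := c.monotone_hilbQuot i hi.le (le_max_right N t)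
    have h5 := c.min_le hi (t := t) (by have := ht hi; omega)
    rw [min_eq_right (by have := ht hi; omega)] at h5
    omega

theorem hilbQuot_sup_eq [IsAlgClosed K] (c : IsReductionChain m I l d) {i : ℕ} (hi : i < m) {t : ℤ}
    (ht : -1 ≤ t) : (hilbQuot (I i ⊔ Ideal.span {l i}) t : ℤ) = min (t + 1) (d i) := by
  have h1 := hilbQuot_add_hilbIdeal (I i ⊔ Ideal.span {l i}) t
  have h2 := hilbIdeal_mono (le_sup_right : Ideal.span {l i} ≤ I i ⊔ Ideal.span {l i}) t
  rw [hilbIdeal_span (c.form_mem i hi) (c.form_ne_zero i hi)] at h2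
  have h3 := hilbIdeal_top_sub (K := K) t ht
  refine le_antisymm (le_min (by omega) ?_) (c.min_le hi ht)
  rcases lt_or_ge t ((d i : ℤ) - 1) with h | h
  · omega
  · have h4 := c.hilbQuot_step hi t
    rw [c.hilbQuot_eq hi.le t fun _ => h, Finset.sum_eq_sum_Ico_succ_bot hi,
      c.hilbQuot_eq (i := i + 1) hi] at h4
    · omega
    · intro hi'
      have := c.anti i hi'
      omega

theorem hilbIdeal_step [IsAlgClosed K] (c : IsReductionChain m I l d) {i : ℕ} (hi : i < m) (t : ℤ) :
    hilbIdeal (I i) t = hilbIdeal (I (i + 1)) (t - 1) + (t + 1 - d i).toNat := by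
  rcases lt_or_ge t (-1) with ht | ht
  · rw [hilbIdeal_of_neg _ (by omega), hilbIdeal_of_neg _ (by omega)]
    omega
  have h1 := c.hilbQuot_step hi t
  have h2 := c.hilbQuot_sup_eq hi ht
  have h3 := hilbIdeal_top_sub (K := K) t ht
  have h4 := hilbQuot_add_hilbIdeal (I i) t
  have h5 := hilbQuot_add_hilbIdeal (I (i + 1)) (t - 1)
  omega

theorem hilbIdeal_zero_eq [IsAlgClosed K] (c : IsReductionChain m I l d) {j : ℕ} (hj : j ≤ m)
    (t : ℤ) : hilbIdeal (I 0) t = hilbIdeal (I j) (t - j) +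
      ∑ k ∈ Finset.range j, (t - k + 1 - d k).toNat := by
  induction j with
  | zero => simp
  | succ j ih =>
    rw [ih (by omega), c.hilbIdeal_step hj, Finset.sum_range_succ]
    push_cast
    rw [show t - (j : ℤ) - 1 = t - (j + 1) by ring]
    ring

theorem add_le_degree (c : IsReductionChain m I l d) {i : ℕ} (hi : i < m) : m ≤ d i + i := by
  have hi' := hi.le
  induction hi' using Nat.decreasingInduction with
  | self => omega
  | of_succ i hi ih =>
    have := c.pos i hi
    by_cases h : i + 1 < m
    · have := ih h
      have := c.anti i h
      omega
    · omega

theorem degree_add_antitone (c : IsReductionChain m I l d) {i j : ℕ} (hij : i ≤ j) (hj : j < m) :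
    d j + j ≤ d i + i := by
  induction j, hij using Nat.le_induction with
  | base => exact le_rfl
  | succ j hij ih =>
    have := ih (by omega)
    have := c.anti j hj
    omega

theorem initialDegree_eq [IsAlgClosed K] (c : IsReductionChain m I l d) :
    initialDegree (I 0) = m := by
  have hmem : ∀ t : ℕ, gradedPiece (I 0) t ≠ ⊥ ↔ hilbIdeal (I 0) t ≠ 0 := fun t =>
    Submodule.finrank_eq_zero.symm.not
  have h0 : ∀ t : ℕ, t < m → hilbIdeal (I 0) t = 0 := by
    intro t ht
    rw [c.hilbIdeal_zero_eq le_rfl, hilbIdeal_of_neg _ (by omega), zero_add]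
    refine Finset.sum_eq_zero fun k hk => ?_
    have := c.add_le_degree (Finset.mem_range.1 hk)
    omega
  have h1 : hilbIdeal (I 0) m ≠ 0 := by
    have h := hilbIdeal_top_natCast (K := K) 0
    rw [c.hilbIdeal_zero_eq le_rfl, c.last_eq, sub_self, ← Nat.cast_zero, h]
    simp
  refine le_antisymm (Nat.sInf_le ((hmem m).2 h1)) (le_csInf ⟨m, (hmem m).2 h1⟩ fun t ht => ?_)
  by_contra! hlt
  exact (hmem t).1 ht (h0 t hlt)

theorem schemeDegree_eq [IsAlgClosed K] (c : IsReductionChain m I l d) :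
    schemeDegree (I 0) = ∑ k ∈ Finset.range m, d k := by
  have h : ∀ᶠ t : ℤ in Filter.atTop, hilbQuot (I 0) t = ∑ k ∈ Finset.range m, d k := by
    filter_upwards [Filter.eventually_ge_atTop ((d 0 : ℤ) - 1)] with t ht
    rw [c.hilbQuot_eq (Nat.zero_le m) t fun _ => ht, Finset.range_eq_Ico]
  have hset : {k : ℕ | ∀ᶠ t : ℤ in Filter.atTop, hilbQuot (I 0) t = k} =
      {∑ k ∈ Finset.range m, d k} := by
    ext k
    refine ⟨fun hk => ?_, fun hk => ?_⟩
    · obtain ⟨t, h1, h2⟩ := (h.and hk).exists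
      exact h2.symm.trans h1
    · rw [Set.mem_singleton_iff] at hk
      subst hk
      exact h
  rw [schemeDegree, hset, csInf_singleton]

theorem regularity_eq [IsAlgClosed K] (c : IsReductionChain m I l d) (hm : 0 < m) :
    regularity (I 0) = d 0 := by
  have h1 : hilbQuot (I 0) ((d 0 : ℤ) - 1) = schemeDegree (I 0) := by
    rw [c.schemeDegree_eq, Finset.range_eq_Ico]
    exact c.hilbQuot_eq (Nat.zero_le m) _ fun _ => le_rfl
  refine le_antisymm (Nat.sInf_le h1) (le_csInf ⟨_, h1⟩ fun t ht => ?_)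
  by_contra! hlt
  have h2 : hilbQuot (I 0) ((t : ℤ) - 1) = schemeDegree (I 0) := ht
  -- If t < d_0, the line contributes only t in degree t - 1 and the residual at most its full
  -- degree, so the total falls short of deg A.
  have h3 := c.hilbQuot_step hm ((t : ℤ) - 1)
  have h4 := c.hilbQuot_sup_eq hm (t := (t : ℤ) - 1) (by omega)
  have h5 := c.monotone_hilbQuot 1 hm (show (t : ℤ) - 1 - 1 ≤ d 0 by omega)
  have h6 := c.hilbQuot_eq (i := 1) hm (d 0) fun h => by
    have : d 1 < d 0 := c.anti 0 h
    omega
  rw [c.schemeDegree_eq, Finset.range_eq_Ico, Finset.sum_eq_sum_Ico_succ_bot hm] at h2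
  simp only [zero_add] at h3 h2
  omega

end IsReductionChain

end Chain

/-! ### Generators and iterated mapping cones. -/

section Resolution

variable {K : Type u} [Field K]

theorem IsReductionChain.exists_generator [IsAlgClosed K] {m : ℕ} {I : ℕ → Ideal (CoordRing K)}
    {l : ℕ → CoordRing K} {d : ℕ → ℕ} (c : IsReductionChain m I l d) {i : ℕ} (hi : i < m) :
    ∃ G ∈ forms K (d i), G ∈ I (i + 1) ∧ ¬ l i ∣ G ∧
      I i = Ideal.span {l i} * I (i + 1) ⊔ Ideal.span {G} := by
  have hl := c.form_mem i hi
  have hl0 := c.form_ne_zero i hi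
  have hmul : I i ⊓ Ideal.span {l i} = Ideal.span {l i} * I (i + 1) := by
    rw [c.succ_eq i hi, inf_span_singleton]
  have hh : ∀ t, hilbIdeal (Ideal.span {l i} * I (i + 1)) t = hilbIdeal (I (i + 1)) (t - 1) :=
    hilbIdeal_span_mul (c.isHomog (i + 1) hi) hl hl0
  obtain ⟨G, hG, hGl⟩ : ∃ G ∈ gradedPiece (I i) (d i), ¬ l i ∣ G := by
    by_contra! h
    have h1 : gradedPiece (I i) (d i) ≤ gradedPiece (I i ⊓ Ideal.span {l i}) (d i) := fun G hG =>
      ⟨hG.1, hG.2, Ideal.mem_span_singleton.2 (h G hG)⟩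
    have h2 : hilbIdeal (I i) (d i) ≤ hilbIdeal (I i ⊓ Ideal.span {l i}) (d i) :=
      Submodule.finrank_mono h1
    rw [hmul, hh, c.hilbIdeal_step hi] at h2
    omega
  have hG0 : G ≠ 0 := by
    rintro rfl
    exact hGl (dvd_zero _)
  refine ⟨G, hG.1, ?_, hGl, ((c.isHomog i hi.le).eq_of_le_of_hilbIdeal_le ?_ fun t => ?_).symm⟩
  · rw [c.succ_eq i hi, Submodule.mem_colon_singleton, smul_eq_mul]
    exact Ideal.mul_mem_right _ _ hG.2
  · rw [← hmul]
    exact sup_le inf_le_left ((Ideal.span_singleton_le_iff_mem _).2 hG.2)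
  · have h1 := hilbIdeal_sup_add_hilbIdeal_inf ((c.isHomog (i + 1) hi).span_mul hl)
      (isHomog_span_singleton hG.1) t
    -- As l_i is a prime not dividing G, the overlap is at most (l_i G). Adjoining G thus adds at
    -- least t - d_i + 1 dimensions in degree t ≥ d_i, which is all that I_i allows.
    have h2 : Ideal.span {l i} * I (i + 1) ⊓ Ideal.span {G} ≤ Ideal.span {l i * G} := by
      rintro f ⟨hf1, hf2⟩
      obtain ⟨r, -, rfl⟩ := Ideal.mem_span_singleton_mul.1 hf1
      obtain ⟨s, hs⟩ := Ideal.mem_span_singleton.1 hf2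
      obtain ⟨q, rfl⟩ := ((prime_of_mem_forms_one hl hl0).dvd_or_dvd ⟨r, hs.symm⟩).resolve_left hGl
      exact Ideal.mem_span_singleton.2 ⟨q, by rw [hs]; ring⟩
    have h3 := hilbIdeal_mono h2 t
    rw [hilbIdeal_span (mul_mem_forms hl hG.1) (mul_ne_zero hl0 hG0)] at h3
    rw [hh, hilbIdeal_span hG.1 hG0] at h1
    have h4 := c.hilbIdeal_step hi t
    rw [show t - (1 + (d i : ℤ)) = t - d i - 1 by ring] at h3
    rcases lt_or_ge (t - d i) (-1) with h | h
    · rw [hilbIdeal_of_neg _ (by omega : t - (d i : ℤ) < 0)] at h1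
      rw [hilbIdeal_of_neg _ (by omega : t - (d i : ℤ) - 1 < 0)] at h3
      omega
    · have h5 := hilbIdeal_top_sub (K := K) (t - d i) h
      omega

theorem MinimalResolution.nu_eq_sum {I : Ideal (CoordRing K)} (F : MinimalResolution I) (t : ℕ) :
    F.nu t = ∑ i, if F.deg₀ i = t then 1 else 0 := by
  rw [nu, Nat.card_eq_fintype_card, Fintype.card_subtype, Finset.card_filter]

theorem MinimalResolution.sigma_eq_sum {I : Ideal (CoordRing K)} (F : MinimalResolution I)
    (t : ℕ) : F.sigma t = ∑ i, if F.deg₁ i = t then 1 else 0 := by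
  rw [sigma, Nat.card_eq_fintype_card, Fintype.card_subtype, Finset.card_filter]

/-- The resolution of the unit ideal. -/
def MinimalResolution.unit : MinimalResolution (⊤ : Ideal (CoordRing K)) where
  rank₀ := 1
  rank₁ := 0
  deg₀ := 0
  deg₁ := 0
  gens := 1
  mat := 0
  gens_homogeneous _ := isHomogeneous_one _ _
  mat_homogeneous _ k := k.elim0
  span_gens := by
    rw [Ideal.eq_top_iff_one]
    exact Ideal.subset_span ⟨0, rfl⟩
  exact v := by
    simp only [Pi.one_apply, mul_one, Finset.univ_unique, Finset.sum_singleton,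
      Matrix.zero_mulVec, exists_const]
    constructor
    · intro h
      ext1 i
      rw [Subsingleton.elim i default, h, Pi.zero_apply]
    · rintro rfl
      rfl
  injective := Function.injective_of_subsingleton _

theorem MinimalResolution.exists_homogeneous_combination {I : Ideal (CoordRing K)}
    (F : MinimalResolution I) {G : CoordRing K} {D : ℕ} (hG : G.IsHomogeneous D) (hGI : G ∈ I) :
    ∃ c : Fin F.rank₀ → CoordRing K, (∀ i, c i ∈ forms K ((D : ℤ) - F.deg₀ i)) ∧
      ∑ i, c i * F.gens i = G := by
  rw [← F.span_gens, Ideal.mem_span_range_iff_exists_fun] at hGI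
  obtain ⟨c, hc⟩ := hGI
  refine ⟨fun i => formComponent ((D : ℤ) - F.deg₀ i) (c i),
    fun i => formComponent_mem_forms _ _, ?_⟩
  rw [← formComponent_of_mem (mem_forms_natCast.2 hG), ← hc, map_sum]
  refine Finset.sum_congr rfl fun i _ => ?_
  rw [mul_comm, mul_comm (c i), formComponent_mul (mem_forms_natCast.2 (F.gens_homogeneous i))]

/-- The mapping cone resolution of `l I + (G)`. -/
theorem MinimalResolution.exists_cone {I J : Ideal (CoordRing K)} (F : MinimalResolution I)
    {l G : CoordRing K} {D : ℕ} (hl : l.IsHomogeneous 1) (hl0 : Prime l) (hG : G.IsHomogeneous D)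
    (hGI : G ∈ I) (hlG : ¬ l ∣ G) (hD : ∀ i, F.deg₀ i < D)
    (hJ : J = Ideal.span {l} * I ⊔ Ideal.span {G}) :
    ∃ E : MinimalResolution J, (∀ i, E.deg₀ i ≤ D) ∧
      ∀ t, E.nu t = (if D = t then 1 else 0) + if t = 0 then 0 else F.nu (t - 1) := by
  obtain ⟨c, hc, hcG⟩ := F.exists_homogeneous_combination hG hGI
  have hc' : ∀ i, (c i).IsHomogeneous (D - F.deg₀ i) := fun i => by
    have := hc i
    rwa [← Nat.cast_sub (hD i).le, mem_forms_natCast] at this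
  -- The new first column is the syzygy l · G - ∑ c_i (l g_i) = 0. Its entries have positive degree
  -- because every `F.deg₀ i` is below D.
  let M : Matrix (Fin (F.rank₀ + 1)) (Fin (F.rank₁ + 1)) (CoordRing K) :=
    Fin.cons (Fin.cons l 0 : Fin (F.rank₁ + 1) → CoordRing K)
      fun i => (Fin.cons (-c i) (F.mat i) : Fin (F.rank₁ + 1) → CoordRing K)
  have hM0 : ∀ w, M.mulVec w 0 = l * w 0 := by
    intro w
    simp [M, Matrix.mulVec, dotProduct, Fin.sum_univ_succ]
  have hMs : ∀ w i, M.mulVec w (Fin.succ i) = -c i * w 0 + F.mat.mulVec (Fin.tail w) i := by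
    intro w i
    simp [M, Matrix.mulVec, dotProduct, Fin.sum_univ_succ, Fin.tail]
  refine ⟨⟨F.rank₀ + 1, F.rank₁ + 1, Fin.cons D fun i => F.deg₀ i + 1,
    Fin.cons (D + 1) fun k => F.deg₁ k + 1, Fin.cons G fun i => l * F.gens i, M,
    ?_, ?_, ?_, ?_, ?_⟩, ?_, ?_⟩
  · intro i
    cases i using Fin.cases with
    | zero => exact hG
    | succ i =>
      rw [Fin.cons_succ, Fin.cons_succ, add_comm]
      exact hl.mul (F.gens_homogeneous i)
  · intro i k
    cases i using Fin.cases with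
    | zero =>
      cases k using Fin.cases with
      | zero => simpa [M] using fun _ => hl
      | succ k => simp [M]
    | succ i =>
      cases k using Fin.cases with
      | zero =>
        have := hD i
        simpa [M, this] using fun _ => (hc' i).neg
      | succ k => simpa [M] using F.mat_homogeneous i k
  · have h : Ideal.span {l} * I = Ideal.span (Set.range fun i => l * F.gens i) := by
      conv_lhs => rw [← F.span_gens, Ideal.span_mul_span', Set.singleton_mul, ← Set.range_comp]
      rfl
    rw [Fin.range_cons, Ideal.span_insert, hJ, sup_comm, h]
  · intro v
    rw [Fin.sum_univ_succ]
    simp only [Fin.cons_zero, Fin.cons_succ]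
    constructor
    · intro h
      have h1 : l ∣ v 0 * G := by
        rw [eq_neg_of_add_eq_zero_left h, dvd_neg]
        exact Finset.dvd_sum fun i _ => ⟨v i.succ * F.gens i, by ring⟩
      obtain ⟨a, ha⟩ := (hl0.dvd_or_dvd h1).resolve_right hlG
      have h2 : ∑ i, (a * c i + v i.succ) * F.gens i = 0 := by
        refine mul_left_cancel₀ hl0.ne_zero ?_
        rw [mul_zero, ← h, ha, ← hcG, Finset.mul_sum, Finset.mul_sum, ← Finset.sum_add_distrib]
        exact Finset.sum_congr rfl fun i _ => by ring
      obtain ⟨w, hw⟩ := (F.exact _).1 h2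
      refine ⟨Fin.cons a w, ?_⟩
      ext1 i
      cases i using Fin.cases with
      | zero => rw [hM0, Fin.cons_zero, ha]
      | succ i =>
        rw [hMs, Fin.cons_zero, Fin.tail_cons, hw]
        ring
    · rintro ⟨w, rfl⟩
      have h1 := (F.exact _).2 ⟨Fin.tail w, rfl⟩
      simp only [hM0, hMs]
      rw [← hcG, Finset.mul_sum, ← Finset.sum_add_distrib]
      calc _ = l * ∑ i, F.mat.mulVec (Fin.tail w) i * F.gens i := by
            rw [Finset.mul_sum]
            exact Finset.sum_congr rfl fun i _ => by ring
        _ = 0 := by rw [h1, mul_zero]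
  · intro w w' h
    have h0 : w 0 = w' 0 := by
      have := congrFun h 0
      rw [hM0, hM0] at this
      exact mul_left_cancel₀ hl0.ne_zero this
    have h1 : Fin.tail w = Fin.tail w' := by
      refine F.injective (funext fun i => ?_)
      have := congrFun h i.succ
      rw [hMs, hMs, h0] at this
      exact add_left_cancel this
    rw [← Fin.cons_self_tail w, ← Fin.cons_self_tail w', h0, h1]
  · intro i
    cases i using Fin.cases with
    | zero => exact le_rfl
    | succ i => simpa using hD i
  · intro t
    rw [MinimalResolution.nu_eq_sum, Fin.sum_univ_succ]
    simp only [Fin.cons_zero, Fin.cons_succ]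
    congr 1
    split_ifs with h
    · simp [h]
    · rw [MinimalResolution.nu_eq_sum]
      refine Finset.sum_congr rfl fun i _ => ?_
      congr 1
      exact propext ⟨fun _ => by omega, fun _ => by omega⟩

/-- The clause on D bounds the generator degrees by d_i, or by 0 when i = m; it supplies the
minimality hypothesis of the next cone. -/
theorem IsReductionChain.exists_minimalResolution_aux [IsAlgClosed K] {m : ℕ}
    {I : ℕ → Ideal (CoordRing K)} {l : ℕ → CoordRing K} {d : ℕ → ℕ}
    (c : IsReductionChain m I l d) {i : ℕ} (hi : i ≤ m) :
    ∃ F : MinimalResolution (I i), (∀ D, 0 < D → (i < m → d i < D) → ∀ k, F.deg₀ k < D) ∧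
      ∀ t, F.nu t = (if t + i = m then 1 else 0) +
        ∑ k ∈ Finset.Ico i m, if d k + k = t + i then 1 else 0 := by
  induction hi using Nat.decreasingInduction with
  | self =>
    rw [c.last_eq]
    refine ⟨MinimalResolution.unit, fun D hD _ _ => hD, fun t => ?_⟩
    rw [MinimalResolution.nu_eq_sum]
    have h : ∀ k, MinimalResolution.unit.deg₀ (K := K) k = 0 := fun _ => rfl
    have hc : (Finset.univ : Finset (Fin (MinimalResolution.unit (K := K)).rank₀)).card = 1 := rfl
    simp [h, hc, eq_comm]
  | of_succ i hi ih =>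
    obtain ⟨F, hF, hnu⟩ := ih
    obtain ⟨G, hG, hGI, hlG, hI⟩ := c.exists_generator hi
    obtain ⟨E, hE, hEnu⟩ := F.exists_cone (mem_forms_natCast.1 (c.form_mem i hi))
      (prime_of_mem_forms_one (c.form_mem i hi) (c.form_ne_zero i hi)) (mem_forms_natCast.1 hG)
      hGI hlG (hF (d i) (c.pos i hi) (c.anti i)) hI
    refine ⟨E, fun D _ hD k => (hE k).trans_lt (hD hi), fun t => ?_⟩
    rw [hEnu, Finset.sum_eq_sum_Ico_succ_bot hi]
    rcases t with _ | t
    · have hz : ∑ k ∈ Finset.Ico (i + 1) m, (if d k + k = 0 + i then 1 else 0) = 0 := by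
        refine Finset.sum_eq_zero fun k hk => if_neg ?_
        have := (Finset.mem_Ico.1 hk).1
        omega
      have := c.pos i hi
      rw [hz, if_pos rfl, if_neg (by omega), if_neg (by omega), if_neg (by omega)]
    · rw [if_neg t.succ_ne_zero, Nat.add_sub_cancel, hnu]
      simp only [show t + (i + 1) = t + 1 + i by ring, Nat.add_right_cancel_iff]
      rw [add_left_comm]

end Resolution

/-! ### Betti numbers are independent of the resolution. -/

section Betti

universe v

variable {K : Type u} [Field K]

theorem eq_C_of_mem_forms_zero {f : CoordRing K} (hf : f ∈ forms K 0) : f = C (constantCoeff f) := by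
  have h : f.IsHomogeneous 0 := mem_forms_natCast.1 hf
  rw [← totalDegree_zero_iff_isHomogeneous] at h
  exact totalDegree_eq_zero_iff_eq_C.1 h

theorem constantCoeff_of_mem_forms {t : ℤ} (ht : t ≠ 0) {f : CoordRing K} (hf : f ∈ forms K t) :
    constantCoeff f = 0 := by
  have h := formComponent_of_mem_ne hf ht
  have h0 : formComponent 0 f = homogeneousComponent 0 f := by
    rw [← formComponent_natCast, Nat.cast_zero]
  rw [h0, homogeneousComponent_zero] at h
  simpa [constantCoeff_eq] using h

theorem hilbIdeal_top (t : ℤ) :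
    hilbIdeal (⊤ : Ideal (CoordRing K)) t = Module.finrank K (forms K t) := by
  rw [hilbIdeal, gradedPiece_top]

namespace MinimalResolution

variable {I : Ideal (CoordRing K)} (F : MinimalResolution I)

theorem mat_mem_forms (i : Fin F.rank₀) (k : Fin F.rank₁) :
    F.mat i k ∈ forms K ((F.deg₁ k : ℤ) - F.deg₀ i) := by
  by_cases h : F.mat i k = 0
  · rw [h]
    exact Submodule.zero_mem _
  · obtain ⟨h1, h2⟩ := F.mat_homogeneous i k h
    rwa [← Nat.cast_sub h1.le, mem_forms_natCast]

theorem constantCoeff_mat (i : Fin F.rank₀) (k : Fin F.rank₁) :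
    constantCoeff (F.mat i k) = 0 := by
  by_cases h : F.mat i k = 0
  · rw [h, map_zero]
  · have h1 := (F.mat_homogeneous i k h).1
    exact constantCoeff_of_mem_forms (by omega) (F.mat_mem_forms i k)

theorem gens_mem (i : Fin F.rank₀) : F.gens i ∈ I := by
  have h : F.gens i ∈ Ideal.span (Set.range F.gens) := Ideal.subset_span ⟨i, rfl⟩
  rwa [F.span_gens] at h

theorem gens_mem_forms (i : Fin F.rank₀) : F.gens i ∈ forms K (F.deg₀ i) :=
  mem_forms_natCast.2 (F.gens_homogeneous i)

theorem constantCoeff_eq_zero_of_relation {v : Fin F.rank₀ → CoordRing K}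
    (hv : ∑ i, v i * F.gens i = 0) (i : Fin F.rank₀) : constantCoeff (v i) = 0 := by
  obtain ⟨w, rfl⟩ := (F.exact v).1 hv
  simp [Matrix.mulVec, dotProduct, F.constantCoeff_mat]

theorem mem_ker_mul_iff {f : CoordRing K} :
    f ∈ RingHom.ker (constantCoeff : CoordRing K →+* K) * I ↔
      ∃ b : Fin F.rank₀ → CoordRing K, (∀ i, constantCoeff (b i) = 0) ∧
        ∑ i, b i * F.gens i = f := by
  constructor
  · intro hf
    have h : f ∈ RingHom.ker (constantCoeff : CoordRing K →+* K) •
        Submodule.span (CoordRing K) (Set.range F.gens) := by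
      rw [show Submodule.span (CoordRing K) (Set.range F.gens) = I from F.span_gens]
      exact hf
    obtain ⟨b, hb, hbf⟩ := (Submodule.mem_ideal_smul_span_iff_exists_sum _ _ _).1 h
    exact ⟨b, hb, by rw [← hbf, Finsupp.sum_fintype _ _ (by simp)]; rfl⟩
  · rintro ⟨b, hb, rfl⟩
    exact Ideal.sum_mem _ fun i _ => Ideal.mul_mem_mul (hb i) (F.gens_mem i)

/-- `ν_t` is the dimension of `(I/𝔪I)_t`, where `𝔪` is the irrelevant ideal. -/
theorem nu_add_hilbIdeal (t : ℕ) :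
    F.nu t + hilbIdeal (RingHom.ker (constantCoeff : CoordRing K →+* K) * I) t =
      hilbIdeal I t := by
  let W := gradedPiece (RingHom.ker (constantCoeff : CoordRing K →+* K) * I) t
  let Φ : ({i // F.deg₀ i = t} → K) × W →ₗ[K] CoordRing K :=
    (Fintype.linearCombination K fun i : {i // F.deg₀ i = t} => F.gens i).coprod W.subtype
  have hΦ : ∀ a w, Φ (a, w) =
      ∑ i, (if h : F.deg₀ i = t then C (a ⟨i, h⟩) else 0) * F.gens i + w := by
    intro a w
    simp only [Φ, LinearMap.coprod_apply, Fintype.linearCombination_apply,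
      Submodule.subtype_apply, dite_mul, zero_mul]
    rw [Finset.sum_dite, Finset.sum_const_zero, add_zero]
    congr 1
    refine Fintype.sum_equiv (Equiv.subtypeEquivRight (by simp)) _ _ fun i => ?_
    simp [smul_eq_C_mul]
  -- Minimality enters here: the coefficients of any relation among the generators have zero
  -- constant term.
  have hinj : Function.Injective Φ := by
    rw [← LinearMap.ker_eq_bot, LinearMap.ker_eq_bot']
    rintro ⟨a, w⟩ h
    rw [hΦ] at h
    obtain ⟨b, hb, hbw⟩ := F.mem_ker_mul_iff.1 w.2.2
    have ha : a = 0 := by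
      ext i
      rw [← hbw, ← Finset.sum_add_distrib] at h
      simp only [← add_mul] at h
      have := F.constantCoeff_eq_zero_of_relation h i
      rw [map_add, hb, add_zero, dif_pos i.2, constantCoeff_C] at this
      exact this
    subst ha
    have hw : (w : CoordRing K) = 0 := by simpa using h
    rw [Prod.mk_eq_zero]
    exact ⟨rfl, Subtype.ext hw⟩
  have hW : W ≤ gradedPiece I t :=
    gradedPiece_mono (I := RingHom.ker (constantCoeff : CoordRing K →+* K) * I)
      Ideal.mul_le_right t
  have hrange : LinearMap.range Φ = gradedPiece I t := by
    apply le_antisymm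
    · rintro _ ⟨⟨a, w⟩, rfl⟩
      rw [hΦ]
      refine Submodule.add_mem _ (Submodule.sum_mem _ fun i _ => ?_)
        (hW w.2)
      split_ifs with h
      · rw [← smul_eq_C_mul]
        refine Submodule.smul_mem _ _ (mem_gradedPiece.2 ⟨?_, F.gens_mem i⟩)
        rw [← h]
        exact F.gens_mem_forms i
      · rw [zero_mul]
        exact Submodule.zero_mem _
    · intro f hf
      obtain ⟨hft, hfI⟩ := mem_gradedPiece.1 hf
      obtain ⟨c, hc, hcf⟩ := F.exists_homogeneous_combination (mem_forms_natCast.1 hft) hfI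
      -- Dropping the constant coefficients leaves the part in 𝔪I.
      let b : Fin F.rank₀ → CoordRing K := fun i => if F.deg₀ i = t then 0 else c i
      have hb : ∑ i, b i * F.gens i ∈ W := by
        refine ⟨Submodule.sum_mem _ fun i _ => ?_, F.mem_ker_mul_iff.2 ⟨b, fun i => ?_, rfl⟩⟩
        · dsimp only [b]
          split_ifs with h
          · rw [zero_mul]
            exact Submodule.zero_mem _
          · simpa using mul_mem_forms (hc i) (F.gens_mem_forms i)
        · dsimp only [b]
          split_ifs with h
          · exact map_zero _
          · exact constantCoeff_of_mem_forms (by omega) (hc i)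
      refine ⟨(fun i => constantCoeff (c i), ⟨_, hb⟩), ?_⟩
      rw [hΦ, ← hcf, ← Finset.sum_add_distrib]
      refine Finset.sum_congr rfl fun i _ => ?_
      dsimp only [b]
      split_ifs with h
      · have h0 : c i ∈ forms K 0 := by simpa [h] using hc i
        rw [← eq_C_of_mem_forms_zero h0]
        ring
      · ring
  have h := LinearMap.finrank_range_of_inj hinj
  rw [hrange, Module.finrank_prod, Module.finrank_fintype_fun_eq_card,
    ← Nat.card_eq_fintype_card] at h
  exact h.symm

theorem nu_eq (F' : MinimalResolution I) (t : ℕ) : F.nu t = F'.nu t := by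
  have h := F.nu_add_hilbIdeal t
  have h' := F'.nu_add_hilbIdeal t
  omega

/-- The Euler characteristic of the degree t strand of the resolution. -/
theorem hilbIdeal_add_sum (t : ℤ) :
    hilbIdeal I t + ∑ k, hilbIdeal (⊤ : Ideal (CoordRing K)) (t - F.deg₁ k) =
      ∑ i, hilbIdeal (⊤ : Ideal (CoordRing K)) (t - F.deg₀ i) := by
  let g : (∀ i, forms K (t - F.deg₀ i)) →ₗ[K] CoordRing K :=
    { toFun := fun v => ∑ i, (v i : CoordRing K) * F.gens i
      map_add' := fun v w => by simp [add_mul, Finset.sum_add_distrib]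
      map_smul' := fun a v => by simp [Finset.smul_sum] }
  have hmat : ∀ (w : ∀ k, forms K (t - F.deg₁ k)) (i : Fin F.rank₀),
      F.mat.mulVec (fun k => (w k : CoordRing K)) i ∈ forms K (t - F.deg₀ i) := by
    intro w i
    change ∑ k, F.mat i k * (w k : CoordRing K) ∈ forms K (t - F.deg₀ i)
    refine Submodule.sum_mem _ fun k _ => ?_
    have := mul_mem_forms (F.mat_mem_forms i k) (w k).2
    rwa [show (F.deg₁ k : ℤ) - F.deg₀ i + (t - F.deg₁ k) = t - F.deg₀ i by ring] at this
  let h : (∀ k, forms K (t - F.deg₁ k)) →ₗ[K] ∀ i, forms K (t - F.deg₀ i) :=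
    { toFun := fun w i => ⟨_, hmat w i⟩
      map_add' := fun v w => by
        ext1 i
        apply Subtype.ext
        simp [Matrix.mulVec, dotProduct, mul_add, Finset.sum_add_distrib]
      map_smul' := fun a v => by
        ext1 i
        apply Subtype.ext
        simp [Matrix.mulVec, dotProduct, Finset.smul_sum] }
  have hh : Function.Injective h := by
    intro v w hvw
    have h1 := F.injective (funext fun i => congrArg Subtype.val (congrFun hvw i))
    exact funext fun k => Subtype.ext (congrFun h1 k)
  have hgr : LinearMap.range g = gradedPiece I t := by
    apply le_antisymm
    · rintro _ ⟨v, rfl⟩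
      change ∑ i, (v i : CoordRing K) * F.gens i ∈ gradedPiece I t
      refine Submodule.sum_mem _ fun i _ =>
        mem_gradedPiece.2 ⟨?_, Ideal.mul_mem_left _ _ (F.gens_mem i)⟩
      simpa using mul_mem_forms (v i).2 (F.gens_mem_forms i)
    · intro f hf
      obtain ⟨hft, hfI⟩ := mem_gradedPiece.1 hf
      rcases lt_or_ge t 0 with ht | ht
      · rw [forms_of_neg ht, Submodule.mem_bot] at hft
        rw [hft]
        exact Submodule.zero_mem _
      · lift t to ℕ using ht
        obtain ⟨c, hc, hcf⟩ := F.exists_homogeneous_combination (mem_forms_natCast.1 hft) hfI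
        exact ⟨fun i => ⟨c i, hc i⟩, hcf⟩
  have hgk : LinearMap.ker g = LinearMap.range h := by
    apply le_antisymm
    · intro v hv
      obtain ⟨w, hw⟩ := (F.exact fun i => (v i : CoordRing K)).1 hv
      refine ⟨fun k => ⟨formComponent (t - F.deg₁ k) (w k), formComponent_mem_forms _ _⟩, ?_⟩
      ext1 i
      apply Subtype.ext
      have h1 := congrFun hw i
      have h2 : formComponent (t - F.deg₀ i) (F.mat.mulVec w i) = v i := by
        rw [h1, formComponent_of_mem (v i).2]
      rw [← h2]
      simp only [h, LinearMap.coe_mk, AddHom.coe_mk, Matrix.mulVec, dotProduct, map_sum]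
      refine Finset.sum_congr rfl fun k _ => ?_
      rw [formComponent_mul (F.mat_mem_forms i k),
        show t - (F.deg₀ i : ℤ) - (F.deg₁ k - F.deg₀ i) = t - F.deg₁ k by ring]
    · rintro _ ⟨w, rfl⟩
      exact (F.exact _).2 ⟨fun k => w k, rfl⟩
  have h1 := LinearMap.finrank_range_add_finrank_ker g
  rw [hgr, hgk, LinearMap.finrank_range_of_inj hh, Module.finrank_pi_fintype,
    Module.finrank_pi_fintype] at h1
  simp only [hilbIdeal_top]
  exact h1

end MinimalResolution

theorem coeff_sum_X_pow_mul_hilbert {ι : Type*} [Fintype ι] (e : ι → ℕ) (t : ℕ) :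
    PowerSeries.coeff t (PowerSeries.mk (fun s => ((∑ i, if e i = s then 1 else 0 : ℕ) : ℤ)) *
      PowerSeries.mk fun s => (hilbIdeal (⊤ : Ideal (CoordRing K)) (s : ℤ) : ℤ)) =
      ((∑ i, hilbIdeal (⊤ : Ideal (CoordRing K)) ((t : ℤ) - e i) : ℕ) : ℤ) := by
  have h : (PowerSeries.mk (fun s => ((∑ i, if e i = s then 1 else 0 : ℕ) : ℤ))) =
      ∑ i, (PowerSeries.X : PowerSeries ℤ) ^ e i := by
    ext s
    simp [PowerSeries.coeff_X_pow, eq_comm]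
  rw [h, Finset.sum_mul, map_sum, Nat.cast_sum]
  refine Finset.sum_congr rfl fun i _ => ?_
  rw [PowerSeries.coeff_X_pow_mul']
  split_ifs with hi
  · rw [PowerSeries.coeff_mk, Nat.cast_sub hi]
  · rw [hilbIdeal_of_neg _ (by omega), Nat.cast_zero]

theorem MinimalResolution.hilbert_series {I : Ideal (CoordRing K)} (F : MinimalResolution I) :
    PowerSeries.mk (fun s => (hilbIdeal I (s : ℤ) : ℤ)) +
      PowerSeries.mk (fun s => (F.sigma s : ℤ)) *
        PowerSeries.mk (fun s => (((s + 2).choose 2 : ℕ) : ℤ)) =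
      PowerSeries.mk (fun s => (F.nu s : ℤ)) *
        PowerSeries.mk fun s => (((s + 2).choose 2 : ℕ) : ℤ) := by
  ext t
  simp only [← hilbIdeal_top_natCast (K := K), F.nu_eq_sum, F.sigma_eq_sum]
  rw [map_add, coeff_sum_X_pow_mul_hilbert, coeff_sum_X_pow_mul_hilbert, PowerSeries.coeff_mk]
  exact_mod_cast F.hilbIdeal_add_sum t

/-- The Hilbert series of R is the same over every field and can be cancelled in the domain ℤ⟦X⟧. -/
theorem MinimalResolution.sigma_eq {I : Ideal (CoordRing K)} (F : MinimalResolution I)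
    {K' : Type v} [Field K'] {I' : Ideal (CoordRing K')} (F' : MinimalResolution I')
    (hI : ∀ t : ℤ, hilbIdeal I t = hilbIdeal I' t) (hnu : ∀ t, F.nu t = F'.nu t) (t : ℕ) :
    F.sigma t = F'.sigma t := by
  have h := F.hilbert_series
  have h' := F'.hilbert_series
  simp only [hI, hnu] at h
  rw [← h', add_right_inj] at h
  have h0 : PowerSeries.mk (fun s => (((s + 2).choose 2 : ℕ) : ℤ)) ≠ 0 := by
    intro h0
    have := congrArg (PowerSeries.coeff 0) h0
    simp at this
  have := congrArg (PowerSeries.coeff t) (mul_right_cancel₀ h0 h)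
  simpa using this

end Betti

/-! ### The split index and the collapse of the bounds. -/

section Main

universe v

variable {K : Type u} [Field K]

/-- The extension by zero of a function on `Fin m` to all natural numbers. -/
def extendFin {α : Type*} [Zero α] {m : ℕ} (f : Fin m → α) (i : ℕ) : α :=
  if h : i < m then f ⟨i, h⟩ else 0

theorem extendFin_of_lt {α : Type*} [Zero α] {m : ℕ} (f : Fin m → α) {i : ℕ} (h : i < m) :
    extendFin f i = f ⟨i, h⟩ := dif_pos h

theorem IsFullReductionVector.isReductionChain [Infinite K] {A : FatPointScheme K} {m : ℕ}
    {L : Fin m → Line K} {d : Fin m → ℕ} (hfull : IsFullReductionVector A L d)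
    (hpos : ∀ i, 0 < d i) (hanti : StrictAnti d) :
    IsReductionChain m (residualIdeal (fatIdeal A) L) (extendFin fun i => (L i).form)
      (extendFin d) where
  isHomog_zero := isHomog_fatIdeal A
  regular_zero := exists_regular_form A
  form_mem i hi := by
    rw [extendFin_of_lt _ hi]
    exact (L ⟨i, hi⟩).form_mem_forms
  form_ne_zero i hi := by
    rw [extendFin_of_lt _ hi]
    exact (L ⟨i, hi⟩).ne_zero
  succ_eq i hi := by
    rw [extendFin_of_lt _ hi, residualIdeal, dif_pos hi]
  last_eq := hfull.2
  degree i hi := by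
    have h := hfull.1 ⟨i, hi⟩
    have h0 := hpos ⟨i, hi⟩
    rw [extendFin_of_lt _ hi, extendFin_of_lt _ hi, h]
    rw [h] at h0
    -- Positivity of d rules out the default value 0 of an empty infimum, so the eventual value
    -- really is attained.
    exact Nat.sInf_mem (Nat.nonempty_of_pos_sInf h0)
  pos i hi := by
    rw [extendFin_of_lt _ hi]
    exact hpos _
  anti i hi := by
    rw [extendFin_of_lt _ hi, extendFin_of_lt _ (by omega)]
    exact hanti (by simp)

theorem hilbIdeal_top_eq {K' : Type v} [Field K'] (t : ℤ) :
    hilbIdeal (⊤ : Ideal (CoordRing K)) t = hilbIdeal (⊤ : Ideal (CoordRing K')) t := by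
  rcases lt_or_ge t 0 with ht | ht
  · rw [hilbIdeal_of_neg _ ht, hilbIdeal_of_neg _ ht]
  · lift t to ℕ using ht
    rw [hilbIdeal_top_natCast, hilbIdeal_top_natCast]

namespace IsReductionChain

variable {m : ℕ} {d : ℕ → ℕ}

theorem hilbIdeal_zero_congr [IsAlgClosed K] {I : ℕ → Ideal (CoordRing K)} {l : ℕ → CoordRing K}
    (c : IsReductionChain m I l d) {K' : Type v} [Field K'] [IsAlgClosed K']
    {I' : ℕ → Ideal (CoordRing K')} {l' : ℕ → CoordRing K'} (c' : IsReductionChain m I' l' d)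
    (t : ℤ) : hilbIdeal (I 0) t = hilbIdeal (I' 0) t := by
  rw [c.hilbIdeal_zero_eq le_rfl, c'.hilbIdeal_zero_eq le_rfl, c.last_eq, c'.last_eq,
    hilbIdeal_top_eq (K' := K')]

theorem nonempty_minimalResolution [IsAlgClosed K] {I : ℕ → Ideal (CoordRing K)}
    {l : ℕ → CoordRing K} (c : IsReductionChain m I l d) : Nonempty (MinimalResolution (I 0)) :=
  let ⟨F, _⟩ := c.exists_minimalResolution_aux (Nat.zero_le m)
  ⟨F⟩

theorem nu_eq [IsAlgClosed K] {I : ℕ → Ideal (CoordRing K)}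
    {l : ℕ → CoordRing K} (c : IsReductionChain m I l d) (F : MinimalResolution (I 0)) (t : ℕ) :
    F.nu t = (if t = m then 1 else 0) + ∑ k ∈ Finset.range m, if d k + k = t then 1 else 0 := by
  obtain ⟨E, -, hE⟩ := c.exists_minimalResolution_aux (Nat.zero_le m)
  rw [F.nu_eq E, hE, Finset.range_eq_Ico, add_zero]

variable {A : FatPointScheme K} {L : Fin m → Line K} {l : ℕ → CoordRing K}

/-- The difference h_{I_A}(t) - h_{I_{A_i}}(t - i) is a sum of truncated terms t - k + 1 - d_k over
k < i, and vanishes exactly when t < d_k + k for all of them. -/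
theorem splitIndex_spec [IsAlgClosed K]
    (c : IsReductionChain m (residualIdeal (fatIdeal A) L) l d) (t : ℕ) :
    splitIndex A L t ≤ m ∧ (∀ k < splitIndex A L t, t < d k + k) ∧
      (splitIndex A L t < m → d (splitIndex A L t) + splitIndex A L t ≤ t) := by
  have hset : {j : ℕ | j ≤ m ∧ ∀ i : ℕ, 1 ≤ i → i ≤ j →
      hilbIdeal (residualIdeal (fatIdeal A) L i) ((t : ℤ) - i) = hilbIdeal (fatIdeal A) t} =
      {j : ℕ | j ≤ m ∧ ∀ k < j, t < d k + k} := by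
    ext j
    refine and_congr_right fun hj => ?_
    have hi : ∀ i ≤ m, hilbIdeal (residualIdeal (fatIdeal A) L i) ((t : ℤ) - i) =
        hilbIdeal (fatIdeal A) t ↔ ∀ k < i, t < d k + k := by
      intro i hi
      have h : hilbIdeal (fatIdeal A) t = _ := c.hilbIdeal_zero_eq hi t
      rw [h, left_eq_add, Finset.sum_eq_zero_iff]
      refine forall_congr' fun k => ?_
      rw [Finset.mem_range]
      refine imp_congr_right fun _ => ?_
      omega
    constructor
    · intro h k hk
      exact (hi (k + 1) (by omega)).1 (h (k + 1) (by omega) hk) k (by omega)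
    · intro h i _ hij
      exact (hi i (hij.trans hj)).2 fun k hk => h k (by omega)
  have hbdd : BddAbove {j : ℕ | j ≤ m ∧ ∀ k < j, t < d k + k} := ⟨m, fun _ h => h.1⟩
  have hmem : splitIndex A L t ∈ {j : ℕ | j ≤ m ∧ ∀ k < j, t < d k + k} := by
    rw [splitIndex, hset]
    exact Nat.sSup_mem ⟨0, by simp⟩ hbdd
  refine ⟨hmem.1, hmem.2, fun hlt => ?_⟩
  by_contra! h
  have h1 : splitIndex A L t + 1 ≤ splitIndex A L t := by
    conv_rhs => rw [splitIndex, hset]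
    refine le_csSup hbdd ⟨hlt, fun k hk => ?_⟩
    rcases Nat.lt_succ_iff_lt_or_eq.1 hk with hk | rfl
    · exact hmem.2 k hk
    · exact h
  omega

/-- At the split index j < m one has t - j - 1 ≥ d_j - 1, so the Hilbert function of A_j is constant
from degree t - j - 1 on; for j = m it is zero. -/
theorem defect_eq_zero [IsAlgClosed K]
    (c : IsReductionChain m (residualIdeal (fatIdeal A) L) l d) (t : ℕ) : defect A L t = 0 := by
  obtain ⟨h1, -, h3⟩ := c.splitIndex_spec t
  rw [defect, diffHilbQuot, c.hilbQuot_eq h1, c.hilbQuot_eq h1, sub_self]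
  all_goals
    intro h
    have := h3 h
    omega

/-- For k < j the summand in degree t + 1 is 1 or 0 according to whether d_k + k = t + 1. As d_k + k
is weakly decreasing in k, no k ≥ j contributes. -/
theorem baseTerm_eq [IsAlgClosed K]
    (c : IsReductionChain m (residualIdeal (fatIdeal A) L) l d) (t : ℕ) :
    baseTerm A L t = (∑ k ∈ Finset.range m, if d k + k = t + 1 then 1 else 0 : ℕ) := by
  obtain ⟨h1, h2, h3⟩ := c.splitIndex_spec t
  have h : hilbIdeal (fatIdeal A) ((t : ℤ) + 1) = _ := c.hilbIdeal_zero_eq h1 (t + 1)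
  rw [baseTerm, h, show (t : ℤ) + 1 - splitIndex A L t = t - splitIndex A L t + 1 by ring,
    Nat.cast_add, add_sub_cancel_left, Nat.cast_inj]
  refine (Finset.sum_congr rfl fun k hk => ?_).trans
    (Finset.sum_subset (Finset.range_mono h1) fun k hk hk' => if_neg ?_)
  · have := h2 k (Finset.mem_range.1 hk)
    split_ifs <;> omega
  · rw [Finset.mem_range] at hk hk'
    have h4 := h3 (by omega)
    have h5 := c.degree_add_antitone (not_lt.1 hk') hk
    omega

end IsReductionChain

end Main

end FatPoints

end

theorem mainTheorem6 {K : Type*} [Field K] [IsAlgClosed K] (n : ℕ)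
    (A : FatPoints.FatPointScheme K) (L : Fin (n + 1) → FatPoints.Line K)
    (d : Fin (n + 1) → ℕ) (hfull : FatPoints.IsFullReductionVector A L d)
    (hpos : ∀ i, 0 < d i) (hanti : StrictAnti d) :
    FatPoints.initialDegree (FatPoints.fatIdeal A) = n + 1 ∧
    FatPoints.regularity (FatPoints.fatIdeal A) = d 0 ∧
    Nonempty (FatPoints.MinimalResolution (FatPoints.fatIdeal A)) ∧
    (∀ t : ℕ, FatPoints.initialDegree (FatPoints.fatIdeal A) ≤ t →
      t < FatPoints.regularity (FatPoints.fatIdeal A) →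
        FatPoints.bettiLower A L t = FatPoints.bettiUpper A L t ∧
        ∀ F : FatPoints.MinimalResolution (FatPoints.fatIdeal A),
          FatPoints.bettiLower A L t ≤ (F.nu (t + 1) : ℤ) ∧
          (F.nu (t + 1) : ℤ) ≤ FatPoints.bettiUpper A L t) ∧
    (∀ (K' : Type*) [Field K'] [IsAlgClosed K'] (A' : FatPoints.FatPointScheme K')
      (L' : Fin (n + 1) → FatPoints.Line K'), FatPoints.IsFullReductionVector A' L' d →
        ∀ (F : FatPoints.MinimalResolution (FatPoints.fatIdeal A))
          (F' : FatPoints.MinimalResolution (FatPoints.fatIdeal A')) (t : ℕ),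
          F.nu t = F'.nu t ∧ F.sigma t = F'.sigma t) := by
  have c := hfull.isReductionChain hpos hanti
  have hα : FatPoints.initialDegree (FatPoints.fatIdeal A) = n + 1 := c.initialDegree_eq
  refine ⟨hα, ?_, c.nonempty_minimalResolution, fun t ht _ => ?_,
    fun K' _ _ A' L' hfull' F F' t => ?_⟩
  · exact (c.regularity_eq n.succ_pos).trans (FatPoints.extendFin_of_lt d n.succ_pos)
  · have hsplit := (c.splitIndex_spec t).1
    have hlower : FatPoints.bettiLower A L t = FatPoints.baseTerm A L t := by
      -- The maximum is 0 because j ≤ n + 1 = α ≤ t.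
      rw [FatPoints.bettiLower, c.defect_eq_zero, max_eq_right (by omega), add_zero]
    have hupper : FatPoints.bettiUpper A L t = FatPoints.baseTerm A L t := by
      rw [FatPoints.bettiUpper, c.defect_eq_zero, add_zero]
    refine ⟨hlower.trans hupper.symm, fun F => ?_⟩
    have hnu : (F.nu (t + 1) : ℤ) = FatPoints.baseTerm A L t := by
      have h : F.nu (t + 1) = _ := c.nu_eq F (t + 1)
      -- The product of all the lines has degree n + 1 < t + 1, so it is not counted here.
      rw [c.baseTerm_eq, h, if_neg (by omega), zero_add]
    exact ⟨(hlower.trans hnu.symm).le, (hnu.trans hupper.symm).le⟩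
  · have c' := hfull'.isReductionChain hpos hanti
    have hnu : ∀ t, F.nu t = F'.nu t := fun t => (c.nu_eq F t).trans (c'.nu_eq F' t).symm
    have hh : ∀ t, FatPoints.hilbIdeal (FatPoints.fatIdeal A) t =
        FatPoints.hilbIdeal (FatPoints.fatIdeal A') t := fun t =>
      FatPoints.IsReductionChain.hilbIdeal_zero_congr c c' t
    exact ⟨hnu t, F.sigma_eq F' hh hnu t⟩
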